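/- For complex $|q|<1$ write $(a;q)_\infty=\prod_{k\ge 0}(1-aq^k)$, $(a_1,\dots,a_m;q)_\infty=\prod_{i=1}^m (a_i;q)_\infty$ and $E_j=(q^j;q^j)_\infty$ for $j\ge 1$. Let $f(a,b)=\sum_{k=-\infty}^{\infty}a^{k(k+1)/2}b^{k(k-1)/2}$ for $|ab|<1$, and put $\varphi(q)=f(q,q)$ and $\psi(q)=f(q,q^3)$. Let the integers $a_{3,10}(n)$ be the coefficients of the Appell–Lerch sum $$\sum_{n=0}^{\infty} a_{3,10}(n)q^n = \frac{1}{(q^3, q^{7}, q^{10}; q^{10})_{\infty}} \sum_{n=-\infty}^{\infty} \frac{(-1)^n q^{5n(n+1)+3n+3}}{1 - q^{10n+3}},$$ expanded in powers of $q$ (in the region $0<|q|<1$, so that $\frac1{1-q^{-m}}=-\frac{q^{m}}{1-q^{m}}$ for $m>0$). Then $$2 \sum_{n=0}^{\infty} a_{3,10}(2n+1)q^n = \frac{E_1^2}{E_5} + 6q \frac{E_2 E_{10}^3}{E_1 E_5^2} - \frac{E_2^2}{E_1^2 E_5} \left(\varphi(q^2)\varphi(q^{10}) - 4q^3\psi(q^4)\psi(q^{20})\right),$$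 and for every integer $n\ge 0$, $$a_{3,10}(10n+5)\equiv 0 \pmod 5.$$ -/

import Mathlib

/-!
All `q`-series are formal power series in `q = X` with integer coefficients.  The infinite sums
and products are the (unconditional) `∑'` and `∏'` for the topology of coefficientwise convergence
on `ℤ⟦X⟧`, where `ℤ` is discrete.  `Ring.inverse f` is the inverse of `f` in the ring `ℤ⟦X⟧`; it is only used
for series with constant coefficient `1`, which are units.
-/

namespace AppellLerch

open PowerSeries
open scoped PowerSeries.WithPiTopology

/-- `(a; u)_∞ = ∏_{k ≥ 0} (1 - a u^k)`. -/
noncomputable def qPochInf (a u : ℤ⟦X⟧) : ℤ⟦X⟧ := ∏' k : ℕ, (1 - a * u ^ k)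

/-- `E_j = (q^j; q^j)_∞`. -/
noncomputable def E (j : ℕ) : ℤ⟦X⟧ := qPochInf (X ^ j) (X ^ j)

/-- Ramanujan's general theta function `f(a, b) = ∑_{k ∈ ℤ} a^{k(k+1)/2} b^{k(k-1)/2}`
(both exponents are nonnegative for every integer `k`). -/
noncomputable def theta (a b : ℤ⟦X⟧) : ℤ⟦X⟧ :=
  ∑' k : ℤ, a ^ (k * (k + 1) / 2).toNat * b ^ (k * (k - 1) / 2).toNat

/-- `φ(u) = f(u, u)`. -/
noncomputable def phi (u : ℤ⟦X⟧) : ℤ⟦X⟧ := theta u u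

/-- `ψ(u) = f(u, u³)`. -/
noncomputable def psi (u : ℤ⟦X⟧) : ℤ⟦X⟧ := theta u (u ^ 3)

/-- The expansion in powers of `q` (that is, for `0 < |q| < 1`) of `1 / (1 - q^d)`, where `d` is a
nonzero integer: for `d < 0` it is `1 / (1 - q^d) = -q^{-d} / (1 - q^{-d})`.
See `recipOneSub_mul`. -/
noncomputable def recipOneSub (d : ℤ) : ℤ⟦X⟧ :=
  if 0 < d then Ring.inverse (1 - X ^ d.toNat) else -X ^ (-d).toNat * Ring.inverse (1 - X ^ (-d).toNat)

/-- The term `(-1)^n q^{p n (n+1)/2 + j n + j} / (1 - q^{p n + j})` of the Appell-Lerch sum; for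
`1 ≤ j < p` the exponent of `q` in the numerator is nonnegative (`appellExponent_nonneg`). -/
noncomputable def appellTerm (j p : ℕ) (n : ℤ) : ℤ⟦X⟧ :=
  (-1) ^ n.natAbs * X ^ ((p : ℤ) * (n * (n + 1) / 2) + j * n + j).toNat *
    recipOneSub ((p : ℤ) * n + j)

/-- The Appell-Lerch sum
`1 / (q^j, q^{p-j}, q^p; q^p)_∞ * ∑_{n ∈ ℤ} (-1)^n q^{p n (n+1)/2 + j n + j} / (1 - q^{p n + j})`,
for `1 ≤ j < p`. -/
noncomputable def appellSeries (j p : ℕ) : ℤ⟦X⟧ :=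
  Ring.inverse
      (qPochInf (X ^ j) (X ^ p) * qPochInf (X ^ (p - j)) (X ^ p) * qPochInf (X ^ p) (X ^ p)) *
    ∑' n : ℤ, appellTerm j p n

/-- The coefficients `a_{j,p}(n)` of the Appell-Lerch sum. -/
noncomputable def a (j p n : ℕ) : ℤ := coeff n (appellSeries j p)

/-! Well-definedness of the inverses, sums and products above. -/

theorem isUnit_of_constantCoeff_eq_one {f : ℤ⟦X⟧} (h : constantCoeff f = 1) : IsUnit f := by
  rw [PowerSeries.isUnit_iff_constantCoeff, h]; exact isUnit_one

theorem isUnit_one_sub_X_pow {m : ℕ} (hm : m ≠ 0) : IsUnit (1 - X ^ m : ℤ⟦X⟧) :=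
  isUnit_of_constantCoeff_eq_one (by simp [hm])

/-- In the ring of Laurent series, `recipOneSub d` is the inverse of `1 - q^d`. -/
theorem recipOneSub_mul {d : ℤ} (hd : d ≠ 0) :
    HahnSeries.ofPowerSeries ℤ ℤ (recipOneSub d) * (1 - HahnSeries.single d 1) = 1 := by
  have key : ∀ m : ℕ, m ≠ 0 →
      HahnSeries.ofPowerSeries ℤ ℤ (Ring.inverse (1 - X ^ m)) * (1 - HahnSeries.single (m : ℤ) 1) = 1 := by
    intro m hm
    have h := congrArg (HahnSeries.ofPowerSeries ℤ ℤ)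
      (Ring.inverse_mul_cancel _ (isUnit_one_sub_X_pow hm))
    simpa [HahnSeries.ofPowerSeries_X_pow] using h
  unfold recipOneSub
  split_ifs with h
  · obtain ⟨m, rfl⟩ := Int.eq_ofNat_of_zero_le h.le
    simpa using key m (by rintro rfl; simp at h)
  · obtain ⟨m, hm⟩ := Int.eq_ofNat_of_zero_le (a := -d) (by lia)
    obtain rfl : d = -(m : ℤ) := by lia
    have hm0 : m ≠ 0 := by rintro rfl; simp at hd
    have hs : (HahnSeries.single (m : ℤ) (1 : ℤ)) * HahnSeries.single (-(m : ℤ)) 1 = 1 := by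
      rw [HahnSeries.single_mul_single]; simp
    have hk := key m hm0
    simp only [neg_neg, Int.toNat_natCast, map_mul, map_neg, HahnSeries.ofPowerSeries_X_pow]
    linear_combination hk + HahnSeries.ofPowerSeries ℤ ℤ (Ring.inverse (1 - X ^ m)) * hs

theorem multipliable_qPochInf (a : ℤ⟦X⟧) {u : ℤ⟦X⟧} (hu : constantCoeff u = 0) :
    Multipliable fun k : ℕ => 1 - a * u ^ k := by
  simp_rw [sub_eq_add_neg]
  apply WithPiTopology.multipliable_one_add_of_tendsto_order_atTop_nhds_top
  refine ENat.tendsto_nhds_top_iff_natCast_lt.mpr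
    (fun n => Filter.eventually_atTop.mpr ⟨n + 1, fun m hm => ?_⟩)
  have h : (X : ℤ⟦X⟧) ^ m ∣ -(a * u ^ m) :=
    ((pow_dvd_pow_of_dvd (X_dvd_iff.mpr hu) m).mul_left a).neg_right
  refine lt_of_lt_of_le ?_ (nat_le_order _ m (X_pow_dvd_iff.mp h))
  exact_mod_cast hm

theorem constantCoeff_qPochInf {a u : ℤ⟦X⟧} (ha : constantCoeff a = 0) (hu : constantCoeff u = 0) :
    constantCoeff (qPochInf a u) = 1 := by
  unfold qPochInf
  rw [(multipliable_qPochInf a hu).map_tprod _ (WithPiTopology.continuous_constantCoeff ℤ)]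
  simp [ha]

theorem summable_of_X_pow_dvd {f : ℤ → ℤ⟦X⟧} (h : ∀ n, X ^ (n.natAbs - 1) ∣ f n) : Summable f := by
  rw [WithPiTopology.summable_iff_summable_coeff]
  intro d
  refine summable_of_hasFiniteSupport ((Set.finite_Icc (-(d + 1 : ℤ)) (d + 1)).subset ?_)
  intro n hn
  by_contra hc
  refine hn (X_pow_dvd_iff.mp (h n) d ?_)
  simp only [Set.mem_Icc, not_and_or] at hc
  lia

theorem two_mul_tri (n : ℤ) : 2 * (n * (n + 1) / 2) = n * (n + 1) :=
  Int.mul_ediv_cancel' (Int.even_mul_succ_self n).two_dvd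

theorem summable_theta {a b : ℤ⟦X⟧} (ha : constantCoeff a = 0) (hb : constantCoeff b = 0) :
    Summable fun k : ℤ => a ^ (k * (k + 1) / 2).toNat * b ^ (k * (k - 1) / 2).toNat := by
  refine summable_of_X_pow_dvd fun k => ?_
  have h1 := pow_dvd_pow_of_dvd (X_dvd_iff.mpr ha) (k * (k + 1) / 2).toNat
  have h2 := pow_dvd_pow_of_dvd (X_dvd_iff.mpr hb) (k * (k - 1) / 2).toNat
  refine dvd_trans ?_ (mul_dvd_mul h1 h2)
  rw [← pow_add]
  apply pow_dvd_pow
  have e1 := two_mul_tri k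
  have e2 := two_mul_tri (k - 1)
  rw [sub_add_cancel, mul_comm (k - 1) k] at e2
  rcases le_or_gt 0 k with hk | hk
  · have : k ≤ k * (k + 1) / 2 := by
      have : k ≤ k * k := by rcases hk.eq_or_lt with h | h <;> nlinarith
      lia
    lia
  · have : -k ≤ k * (k - 1) / 2 := by nlinarith
    lia

theorem appellExponent_nonneg {j p : ℕ} (hjp : j < p) (n : ℤ) :
    0 ≤ (p : ℤ) * (n * (n + 1) / 2) + j * n + j := by
  have e := two_mul_tri n
  have hp : (j : ℤ) + 1 ≤ p := by exact_mod_cast hjp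
  have hj : (0 : ℤ) ≤ j := by positivity
  have e2 : 2 * ((p : ℤ) * (n * (n + 1) / 2) + j * n + j) = (n + 1) * (p * n + 2 * j) := by
    linear_combination (p : ℤ) * e
  suffices 0 ≤ (n + 1) * (p * n + 2 * j) by lia
  rcases lt_trichotomy n (-1) with hn | rfl | hn
  · exact mul_nonneg_of_nonpos_of_nonpos (by lia) (by nlinarith)
  · simp
  · have hn' : 0 ≤ n := by lia
    positivity

theorem summable_appellTerm {j p : ℕ} (hjp : j < p) : Summable (appellTerm j p) := by
  refine summable_of_X_pow_dvd fun n => ?_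
  have e := two_mul_tri n
  have h0 := appellExponent_nonneg hjp n
  have hp : (j : ℤ) + 1 ≤ p := by exact_mod_cast hjp
  have hj : (0 : ℤ) ≤ j := by positivity
  unfold appellTerm
  rcases le_or_gt 0 n with hn | hn
  · refine (Dvd.dvd.mul_left (pow_dvd_pow X ?_) _).mul_right _
    have h1 : n ≤ n * (n + 1) / 2 := by
      have : n ≤ n * n := by rcases hn.eq_or_lt with h | h <;> nlinarith
      lia
    have h2 : n ≤ p * (n * (n + 1) / 2) := by nlinarith
    have h3 : 0 ≤ j * n := by positivity
    lia
  · have hd : (p : ℤ) * n + j < 0 := by nlinarith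
    rw [recipOneSub, if_neg (by lia), ← mul_assoc, mul_assoc ((-1) ^ n.natAbs), mul_neg,
      ← pow_add]
    refine Dvd.dvd.mul_right (Dvd.dvd.mul_left ((dvd_neg (α := ℤ⟦X⟧)).mpr (pow_dvd_pow X ?_)) _) _
    have h1 : -2 * n ≤ 2 * (((p : ℤ) * (n * (n + 1) / 2) + j * n + j) + -(p * n + j)) := by
      have : 2 * (((p : ℤ) * (n * (n + 1) / 2) + j * n + j) + -(p * n + j)) =
          (-n) * (p * (1 - n) - 2 * j) := by linear_combination (p : ℤ) * e
      rw [this]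
      have : 2 ≤ (p : ℤ) * (1 - n) - 2 * j := by nlinarith
      nlinarith
    lia

end AppellLerch

/-!
Replacing `q` by `-q` isolates the odd part of the Appell–Lerch series. With `Θ(±1)` and `A(±1)`
the theta series in the denominator and the Appell–Lerch sum, before and after this substitution,
the odd part comes from `Θ(1) A(1) - Θ(-1) A(-1)`. Under a shift of the summation index each `A`
satisfies a quasi-periodicity relation whose inhomogeneous term is a theta series, and these terms
cancel in the combination. The shifted combinations are thus explicit multiples of one of them.
Summing them against a theta series and interchanging the two sums leaves only alternating sums
`∑ (-1)^n q^{r n (n + 1)} / (1 - δ q^{2 r n + k})`, which are the partial fraction expansions of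
reciprocals of theta series. Like the triple product, these expansions are limits of finite
identities for Gaussian binomial coefficients. The odd part is therefore a quotient of theta
series.

For `p = 10` and `j = 3` the three-term relations at level 10 and the dissection of `φ(q)²` along
the ideal `(2 - i)` of the Gaussian integers determine the square of the theta function combination
`φ(q²) φ(q¹⁰) - 4 q³ ψ(q⁴) ψ(q²⁰)`; the sign of the root is read off the constant coefficient.

For the congruence, modulo multiplication by a power of `E_5`, which preserves residue classes of
exponents modulo 5, the terms of the formula become `ψ⁴ - q² ψ(q⁵)⁴` and `ψ³ - q ψ(q⁵)² ψ`. The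
5-dissection `ψ(q²) = A + B + C` has exponents in the classes 0, 2 and 1, and
`q² ψ(q¹⁰)² = A B + C²`, so the coefficients in the relevant class are visibly multiples of 5.
-/

namespace AppellLerch

open PowerSeries Filter Topology
open scoped PowerSeries.WithPiTopology

/-! ### Summable families of power series -/

section NullFamilies

variable {ι κ R : Type*} [CommRing R]

/-- A family of power series tending to `0` in the `X`-adic sense along the cofinite filter: only
finitely many members are not divisible by any given power of `X`. -/
def IsNullFamily (f : ι → R⟦X⟧) : Prop := ∀ d : ℕ, {i | ¬ X ^ d ∣ f i}.Finite

namespace IsNullFamily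

variable {f : ι → R⟦X⟧} {g : κ → R⟦X⟧}

theorem of_dvd {g : ι → R⟦X⟧} (hf : IsNullFamily f) (h : ∀ i, f i ∣ g i) : IsNullFamily g :=
  fun d => (hf d).subset fun i hi hd => hi (hd.trans (h i))

theorem of_X_pow_dvd {f : ℤ → R⟦X⟧} (h : ∀ n, X ^ (n.natAbs - 1) ∣ f n) : IsNullFamily f := by
  intro d
  refine (Set.finite_Icc (-(d + 1 : ℤ)) (d + 1)).subset fun n hn => ?_
  by_contra hc
  refine hn ((pow_dvd_pow X ?_).trans (h n))
  simp only [Set.mem_Icc, not_and_or] at hc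
  lia

theorem comp_injective (hf : IsNullFamily f) {e : κ → ι} (he : Function.Injective e) :
    IsNullFamily fun k => f (e k) :=
  fun d => (hf d).preimage he.injOn

theorem mul_left (hf : IsNullFamily f) (c : R⟦X⟧) : IsNullFamily fun i => c * f i :=
  hf.of_dvd fun _ => dvd_mul_left ..

theorem prod (hf : IsNullFamily f) (hg : IsNullFamily g) :
    IsNullFamily fun x : ι × κ => f x.1 * g x.2 :=
  fun d => ((hf d).prod (hg d)).subset fun _ hx =>
    ⟨fun h => hx (h.mul_right _), fun h => hx (h.mul_left _)⟩

theorem fiber {f : ι × κ → R⟦X⟧} (hf : IsNullFamily f) (i : ι) :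
    IsNullFamily fun k => f (i, k) :=
  hf.comp_injective (Prod.mk_right_injective i)

variable [TopologicalSpace R]

theorem summable (hf : IsNullFamily f) : Summable f := by
  rw [WithPiTopology.summable_iff_summable_coeff]
  intro d
  refine summable_of_hasFiniteSupport ((hf (d + 1)).subset fun i hi hd => hi ?_)
  exact X_pow_dvd_iff.mp hd d d.lt_succ_self

variable [T2Space R]

/-- Dominated convergence. -/
theorem tendsto_sum (hf : IsNullFamily f) {u : ℕ → ι → R⟦X⟧} {v : ι → R⟦X⟧}
    (hu : ∀ n i, f i ∣ u n i) (hv : ∀ i, f i ∣ v i)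
    (huv : ∀ i, Tendsto (u · i) atTop (𝓝 (v i))) [ContinuousAdd R] (s : ℕ → Finset ι)
    (hs : ∀ i, ∀ᶠ n in atTop, i ∈ s n) :
    Tendsto (fun n => ∑ i ∈ s n, u n i) atTop (𝓝 (∑' i, v i)) := by
  rw [WithPiTopology.tendsto_iff_coeff_tendsto]
  intro d
  set t := (hf (d + 1)).toFinset with ht
  have coeff_eq_zero : ∀ x : R⟦X⟧, ∀ i ∉ t, f i ∣ x → coeff d x = 0 := by
    intro x i hi hx
    rw [ht, Set.Finite.mem_toFinset, Set.mem_ofPred_eq, not_not] at hi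
    exact X_pow_dvd_iff.mp (hi.trans hx) d d.lt_succ_self
  have coeff_tsum : coeff d (∑' i, v i) = ∑ i ∈ t, coeff d (v i) := by
    rw [(hf.of_dvd hv).summable.map_tsum _ (WithPiTopology.continuous_coeff R d)]
    exact tsum_eq_sum fun i hi => coeff_eq_zero _ i hi (hv i)
  rw [coeff_tsum]
  refine (tendsto_finsetSum t fun i _ =>
    ((WithPiTopology.tendsto_iff_coeff_tendsto ..).mp (huv i) d)).congr' ?_
  have t_subset : ∀ᶠ n in atTop, t ⊆ s n := by
    simp only [Finset.subset_iff]
    exact (eventually_all_finset _).mpr fun i _ => hs i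
  filter_upwards [t_subset] with n hn
  rw [map_sum]
  exact Finset.sum_subset hn fun i _ hi => coeff_eq_zero _ i hi (hu n i)

variable [IsTopologicalRing R]

theorem mul_tsum (hf : IsNullFamily f) (c : R⟦X⟧) : c * ∑' i, f i = ∑' i, c * f i :=
  (hf.summable.tsum_mul_left c).symm

theorem tsum_mul_tsum (hf : IsNullFamily f) (hg : IsNullFamily g) :
    (∑' i, f i) * ∑' k, g k = ∑' x : ι × κ, f x.1 * g x.2 :=
  hf.summable.tsum_mul_tsum hg.summable (hf.prod hg).summable

theorem tsum_prod {f : ι × κ → R⟦X⟧} (hf : IsNullFamily f) :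
    ∑' x, f x = ∑' (i : ι) (k : κ), f (i, k) :=
  hf.summable.tsum_prod' fun i => (hf.fiber i).summable

theorem tsum_comm {f : ι × κ → R⟦X⟧} (hf : IsNullFamily f) :
    ∑' (i : ι) (k : κ), f (i, k) = ∑' (k : κ) (i : ι), f (i, k) := by
  rw [← hf.tsum_prod, ← (Equiv.prodComm κ ι).tsum_eq,
    (hf.comp_injective (Equiv.injective _)).tsum_prod]
  rfl

theorem tsum_eq_sum_tsum {σ : Type*} [Fintype σ] (hf : IsNullFamily f) (e : σ × κ ≃ ι) :
    ∑' i, f i = ∑ c, ∑' k, f (e (c, k)) := by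
  rw [← e.tsum_eq f, (hf.comp_injective e.injective).tsum_prod, tsum_fintype]

end IsNullFamily

end NullFamilies

/-! ### Theta series -/

/-- The monomial `ε q^a` for a sign `ε`; the integer `a` is meant to be nonnegative. -/
noncomputable def qPow (ε : ℤˣ) (a : ℤ) : ℤ⟦X⟧ := ((ε : ℤ) : ℤ⟦X⟧) * X ^ a.toNat

@[simp] theorem qPow_one_zero : qPow 1 0 = 1 := by simp [qPow]

theorem qPow_natCast (ε : ℤˣ) (a : ℕ) : qPow ε a = ((ε : ℤ) : ℤ⟦X⟧) * X ^ a := by simp [qPow]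

theorem qPow_one_natCast (a : ℕ) : qPow 1 a = X ^ a := by simp [qPow]

theorem qPow_one_ofNat (a : ℕ) [a.AtLeastTwo] : qPow 1 ofNat(a) = X ^ (ofNat(a) : ℕ) :=
  qPow_one_natCast a

theorem qPow_one_one : qPow 1 1 = X := by simp [qPow]

theorem qPow_neg (ε : ℤˣ) (a : ℤ) : qPow (-ε) a = -qPow ε a := by simp [qPow]

theorem qPow_mul_qPow (ε δ : ℤˣ) {a b : ℤ} (ha : 0 ≤ a) (hb : 0 ≤ b) :
    qPow ε a * qPow δ b = qPow (ε * δ) (a + b) := by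
  unfold qPow
  rw [Int.toNat_add ha hb, pow_add]
  push_cast
  ring

theorem X_pow_dvd_qPow (ε : ℤˣ) {a : ℤ} {d : ℕ} (h : d ≤ a) : X ^ d ∣ qPow ε a :=
  Dvd.dvd.mul_left (pow_dvd_pow X (by lia)) _

theorem units_zpow_two_mul (ε : ℤˣ) (n : ℤ) : ε ^ (2 * n) = 1 := by
  rw [zpow_mul, zpow_ofNat, Int.units_sq, one_zpow]

theorem units_zpow_add_mul_zpow_sub (ε δ : ℤˣ) (m n : ℤ) :
    ε ^ (m + n) * δ ^ (m - n) = (ε * δ) ^ m * (ε * δ) ^ n := by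
  rw [zpow_sub, Int.units_inv_eq_self, zpow_add, mul_zpow, mul_zpow]
  exact mul_mul_mul_comm ..

/-- `∑ εⁿ q^{r n (n - 1) + k n}`, which is `f(ε q^k, ε q^{2r - k})` in terms of Ramanujan's theta
function. -/
noncomputable def thetaSeries (r k : ℤ) (ε : ℤˣ) : ℤ⟦X⟧ :=
  ∑' n : ℤ, qPow (ε ^ n) (r * (n * (n - 1)) + k * n)

local notation "Θ" => thetaSeries

theorem two_mul_natAbs_pred_le_mul_succ (n : ℤ) : 2 * ((n.natAbs - 1 : ℕ) : ℤ) ≤ n * (n + 1) := by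
  obtain h | h | h : n ≤ -2 ∨ n = -1 ∨ 0 ≤ n := by lia
  · have : (n.natAbs - 1 : ℕ) = -(n + 1) := by lia
    nlinarith
  · simp [h]
  · have : ((n.natAbs - 1 : ℕ) : ℤ) ≤ n := by lia
    obtain rfl | h : n = 0 ∨ 1 ≤ n := by lia
    · simp
    · nlinarith

theorem natAbs_pred_mul_le_thetaExponent {r k : ℤ} (hk : 0 ≤ k) (hr : k ≤ 2 * r) (n : ℤ) :
    2 * r * ((n.natAbs - 1 : ℕ) : ℤ) ≤ r * (n * (n - 1)) + k * n := by
  have h := mul_le_mul_of_nonneg_left (two_mul_natAbs_pred_le_mul_succ n) hk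
  have h' := mul_le_mul_of_nonneg_left (two_mul_natAbs_pred_le_mul_succ (-n)) (sub_nonneg.mpr hr)
  rw [Int.natAbs_neg] at h'
  linarith

theorem thetaExponent_nonneg {r k : ℤ} (hk : 0 ≤ k) (hr : k ≤ 2 * r) (n : ℤ) :
    0 ≤ r * (n * (n - 1)) + k * n :=
  le_trans (mul_nonneg (hk.trans hr) (Int.natCast_nonneg _))
    (natAbs_pred_mul_le_thetaExponent hk hr n)

theorem isNullFamily_thetaTerm {r k : ℤ} (h0 : 0 < r) (hk : 0 ≤ k) (hr : k ≤ 2 * r) (ε : ℤ → ℤˣ) :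
    IsNullFamily fun n : ℤ => qPow (ε n) (r * (n * (n - 1)) + k * n) :=
  .of_X_pow_dvd fun n => X_pow_dvd_qPow _ <|
    (le_mul_of_one_le_left (Int.natCast_nonneg _) (by lia)).trans
      (natAbs_pred_mul_le_thetaExponent hk hr n)

theorem thetaSeries_reflect (r k : ℤ) (ε : ℤˣ) : Θ r (2 * r - k) ε = Θ r k ε := by
  unfold thetaSeries
  rw [← (Equiv.neg ℤ).tsum_eq]
  refine tsum_congr fun n => ?_
  rw [Equiv.neg_apply, zpow_neg, Int.units_inv_eq_self]
  congr 1
  ring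

theorem thetaSeries_zero_neg_one (r : ℤ) : Θ r 0 (-1) = 0 := by
  have eq_neg : Θ r 0 (-1) = -Θ r 0 (-1) := by
    unfold thetaSeries
    conv_lhs => rw [← (Equiv.subLeft (1 : ℤ)).tsum_eq]
    rw [← tsum_neg]
    refine tsum_congr fun n => ?_
    rw [← qPow_neg, Equiv.subLeft_apply]
    congr 1
    · rw [zpow_sub, Int.units_inv_eq_self, zpow_one, neg_one_mul]
    · ring
  ext n
  exact self_eq_neg.mp ((congrArg (coeff n) eq_neg).trans (map_neg ..))

/-- Pairs of integers, split according to the parity of their sum. -/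
def parityEquiv : Fin 2 × ℤ × ℤ ≃ ℤ × ℤ where
  toFun x := (x.2.1 + x.2.2, x.2.1 - x.2.2 + x.1.val)
  invFun y := (if (y.1 + y.2) % 2 = 0 then 0 else 1, (y.1 + y.2) / 2, (y.1 - y.2 + 1) / 2)
  left_inv := by
    rintro ⟨b, m, n⟩
    fin_cases b <;> simp <;> lia
  right_inv := by
    rintro ⟨m, n⟩
    simp only [Prod.mk.injEq]
    split_ifs <;> simp <;> lia

theorem thetaSeries_mul_thetaSeries {r k l : ℤ} (h0 : 0 < r) (hl : 0 ≤ l) (hlk : l ≤ k)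
    (hkl : k + l ≤ 2 * r) (ε δ : ℤˣ) :
    Θ r k ε * Θ r l δ = Θ (2 * r) (k + l) (ε * δ) * Θ (2 * r) (k - l + 2 * r) (ε * δ) +
      qPow δ l * Θ (2 * r) (k + l + 2 * r) (ε * δ) * Θ (2 * r) (k - l) (ε * δ) := by
  have hk : 0 ≤ k := hl.trans hlk
  have null_ε := isNullFamily_thetaTerm h0 hk (by lia) (ε ^ ·)
  have null_δ := isNullFamily_thetaTerm h0 hl (by lia) (δ ^ ·)
  have null {c : ℤ} (hc : 0 ≤ c) (hc' : c ≤ 2 * (2 * r)) :=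
    isNullFamily_thetaTerm (mul_pos two_pos h0) hc hc' ((ε * δ) ^ ·)
  have exp_k := thetaExponent_nonneg (r := r) hk (by lia)
  have exp_l := thetaExponent_nonneg (r := r) hl (by lia)
  unfold thetaSeries
  rw [null_ε.tsum_mul_tsum null_δ, (null_ε.prod null_δ).tsum_eq_sum_tsum parityEquiv,
    Fin.sum_univ_two, mul_assoc (qPow δ l),
    (null (by lia) (by lia)).tsum_mul_tsum (null (by lia) (by lia)),
    (null (by lia) (by lia)).tsum_mul_tsum (null (by lia) (by lia)),
    ((null (by lia) (by lia)).prod (null (by lia) (by lia))).mul_tsum]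
  congr 1 <;> refine tsum_congr fun ⟨m, n⟩ => ?_
  · simp only [parityEquiv, Equiv.coe_fn_mk, Fin.val_zero, Nat.cast_zero, add_zero]
    rw [qPow_mul_qPow _ _ (exp_k _) (exp_l _),
      qPow_mul_qPow _ _ (thetaExponent_nonneg (by lia) (by lia) _)
        (thetaExponent_nonneg (by lia) (by lia) _), units_zpow_add_mul_zpow_sub]
    congr 1
    ring
  · simp only [parityEquiv, Equiv.coe_fn_mk, Fin.val_one, Nat.cast_one]
    have exp_add := thetaExponent_nonneg (r := 2 * r) (k := k + l + 2 * r) (by lia) (by lia) m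
    have exp_sub := thetaExponent_nonneg (r := 2 * r) (k := k - l) (by lia) (by lia) n
    rw [qPow_mul_qPow _ _ (exp_k _) (exp_l _), qPow_mul_qPow _ _ exp_add exp_sub,
      qPow_mul_qPow _ _ hl (add_nonneg exp_add exp_sub), zpow_add_one δ,
      ← units_zpow_add_mul_zpow_sub, ← mul_assoc (ε ^ (m + n)), mul_comm _ δ]
    congr 1
    ring

/-- Weierstrass's three-term relation. By `thetaSeries_mul_thetaSeries` each product
`Θ (x + y + c) * Θ (x - y)` is a 2 × 2 minor of one and the same matrix, and the relation is the
Plücker relation between these minors. -/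
theorem thetaSeries_three_term {r c x y z : ℤ} (hr : 0 < r) (hc : 0 ≤ c) (hz : 0 ≤ z) (hzy : z ≤ y)
    (hyx : y ≤ x) (hx : 2 * x + c ≤ 2 * r) :
    Θ r (x + z + c) (-1) * Θ r (x - z) (-1) * (Θ r (y + c) (-1) * Θ r y (-1)) =
      qPow 1 (y - z) * (Θ r (x + y + c) (-1) * Θ r (x - y) (-1)) *
          (Θ r (z + c) (-1) * Θ r z (-1)) +
        Θ r (x + c) (-1) * Θ r x (-1) * (Θ r (y + z + c) (-1) * Θ r (y - z) (-1)) := by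
  have minor {s t : ℤ} (ht : 0 ≤ t) (hts : t ≤ s) (hs : s ≤ x) :
      Θ r (s + t + c) (-1) * Θ r (s - t) (-1) =
        Θ (2 * r) (2 * s + c) 1 * Θ (2 * r) (2 * t + c + 2 * r) 1 -
          qPow 1 (s - t) * Θ (2 * r) (2 * s + c + 2 * r) 1 * Θ (2 * r) (2 * t + c) 1 := by
    rw [thetaSeries_mul_thetaSeries hr (by lia) (by lia) (by lia), neg_one_mul, neg_neg, qPow_neg,
      show s + t + c + (s - t) = 2 * s + c by ring, show s + t + c - (s - t) = 2 * t + c by ring]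
    ring
  have minor_zero {s : ℤ} (hs : 0 ≤ s) (hsx : s ≤ x) := minor le_rfl hs hsx
  simp only [add_zero, sub_zero, mul_zero, zero_add] at minor_zero
  have qPow_split {s t : ℤ} (ht : 0 ≤ t) (hts : t ≤ s) : qPow 1 s = qPow 1 (s - t) * qPow 1 t := by
    rw [qPow_mul_qPow _ _ (sub_nonneg.mpr hts) ht, one_mul, sub_add_cancel]
  have q_xz := qPow_split (s := x - z) (t := y - z) (by lia) (by lia)
  rw [sub_sub_sub_cancel_right] at q_xz
  have hy : 0 ≤ y := hz.trans hzy
  rw [minor hz (hzy.trans hyx) le_rfl, minor hy hyx le_rfl, minor hz hzy hyx, minor_zero hy hyx,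
    minor_zero hz (hzy.trans hyx), minor_zero (hy.trans hyx) le_rfl, q_xz, qPow_split hy hyx,
    qPow_split hz hzy]
  ring

/-! ### Dissections -/

/-- The integers, split according to parity. -/
def evenOddEquiv : Fin 2 × ℤ ≃ ℤ where
  toFun x := 2 * x.2 + x.1.val
  invFun n := (if n % 2 = 0 then 0 else 1, n / 2)
  left_inv := by
    rintro ⟨b, m⟩
    fin_cases b
    · simp
    · simp
      lia
  right_inv n := by
    dsimp only
    split_ifs <;> simp <;> lia

theorem thetaSeries_eq_even_add_odd {r k : ℤ} (h0 : 0 < r) (hk : 0 ≤ k) (hkr : k ≤ r) (ε : ℤˣ) :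
    Θ r k ε = Θ (4 * r) (2 * r + 2 * k) 1 + qPow ε k * Θ (4 * r) (6 * r + 2 * k) 1 := by
  unfold thetaSeries
  rw [(isNullFamily_thetaTerm h0 hk (by lia) (ε ^ ·)).tsum_eq_sum_tsum evenOddEquiv,
    Fin.sum_univ_two,
    (isNullFamily_thetaTerm (by lia) (by lia) (by lia) (1 ^ · : ℤ → ℤˣ)).mul_tsum]
  congr 1 <;> refine tsum_congr fun n => ?_
  · simp only [evenOddEquiv, Equiv.coe_fn_mk, Fin.val_zero, Nat.cast_zero, add_zero,
      units_zpow_two_mul, one_zpow]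
    congr 1
    ring
  · rw [qPow_mul_qPow _ _ hk (thetaExponent_nonneg (by lia) (by lia) n)]
    simp only [evenOddEquiv, Equiv.coe_fn_mk, Fin.val_one, Nat.cast_one, zpow_add,
      units_zpow_two_mul, one_zpow, zpow_one, one_mul, mul_one]
    congr 1
    ring

theorem thetaSeries_zero_one {r : ℤ} (h0 : 0 < r) : Θ r 0 1 = 2 * Θ (4 * r) (2 * r) 1 := by
  have reflect := thetaSeries_reflect (4 * r) (2 * r) 1
  rw [show 2 * (4 * r) - 2 * r = 6 * r by ring] at reflect
  rw [thetaSeries_eq_even_add_odd h0 le_rfl h0.le, mul_zero, add_zero, add_zero, reflect,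
    qPow_one_zero]
  ring

/-- The Gaussian integers, split into the cosets of the ideal `(2 - i)` with representatives `g`;
`m + 2 n` modulo `5` is the class of `m + n i`. -/
def gaussEquiv (g : Fin 5 → ℤ × ℤ) (hg : ∀ c, ((g c).1 + 2 * (g c).2) % 5 = c) :
    Fin 5 × ℤ × ℤ ≃ ℤ × ℤ where
  toFun x := (2 * x.2.1 + x.2.2 + (g x.1).1, 2 * x.2.2 - x.2.1 + (g x.1).2)
  invFun y :=
    let c : Fin 5 := ⟨((y.1 + 2 * y.2) % 5).toNat, by lia⟩
    (c, (2 * (y.1 - (g c).1) - (y.2 - (g c).2)) / 5,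
      ((y.1 - (g c).1) + 2 * (y.2 - (g c).2)) / 5)
  left_inv := by
    rintro ⟨c, a, b⟩
    have h : (⟨((2 * a + b + (g c).1 + 2 * (2 * b - a + (g c).2)) % 5).toNat,
        by lia⟩ : Fin 5) = c := by
      ext
      have := hg c
      dsimp only
      lia
    dsimp only
    rw [h]
    simp only [Prod.mk.injEq, true_and]
    constructor <;> lia
  right_inv := by
    rintro ⟨m, n⟩
    have := hg ⟨((m + 2 * n) % 5).toNat, by lia⟩
    rw [Int.toNat_of_nonneg (by lia)] at this
    simp only [Prod.mk.injEq]
    generalize (⟨((m + 2 * n) % 5).toNat, by lia⟩ : Fin 5) = c at *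
    constructor <;> lia

theorem thetaSeries_mul_thetaSeries_gauss {r k l : ℤ} (h0 : 0 < r) (hk : 0 ≤ k) (hkr : k ≤ 2 * r)
    (hl : 0 ≤ l) (hlr : l ≤ 2 * r) (ε : ℤˣ) (g : Fin 5 → ℤ × ℤ)
    (hg : ∀ c, ((g c).1 + 2 * (g c).2) % 5 = c)
    (hg₁ : ∀ c, 2 * r * (2 * (g c).1 - (g c).2 + 2) + 2 * k - l ∈ Set.Icc 0 (2 * (5 * r)))
    (hg₂ : ∀ c, 2 * r * ((g c).1 + 2 * (g c).2 + 1) + k + 2 * l ∈ Set.Icc 0 (2 * (5 * r))) :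
    Θ r k ε * Θ r l ε = ∑ c, qPow (ε ^ ((g c).1 + (g c).2))
          (r * ((g c).1 * ((g c).1 - 1)) + k * (g c).1 +
            (r * ((g c).2 * ((g c).2 - 1)) + l * (g c).2)) *
        (Θ (5 * r) (2 * r * (2 * (g c).1 - (g c).2 + 2) + 2 * k - l) ε *
          Θ (5 * r) (2 * r * ((g c).1 + 2 * (g c).2 + 1) + k + 2 * l) ε) := by
  have null_k := isNullFamily_thetaTerm h0 hk hkr (ε ^ ·)
  have null_l := isNullFamily_thetaTerm h0 hl hlr (ε ^ ·)
  have null₁ c := isNullFamily_thetaTerm (r := 5 * r) (by lia) (hg₁ c).1 (hg₁ c).2 (ε ^ ·)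
  have null₂ c := isNullFamily_thetaTerm (r := 5 * r) (by lia) (hg₂ c).1 (hg₂ c).2 (ε ^ ·)
  have exp_k := thetaExponent_nonneg hk hkr
  have exp_l := thetaExponent_nonneg hl hlr
  unfold thetaSeries
  rw [null_k.tsum_mul_tsum null_l, (null_k.prod null_l).tsum_eq_sum_tsum (gaussEquiv g hg)]
  refine Finset.sum_congr rfl fun c _ => ?_
  rw [(null₁ c).tsum_mul_tsum (null₂ c), ((null₁ c).prod (null₂ c)).mul_tsum]
  refine tsum_congr fun ⟨a, b⟩ => ?_
  have exp₁ := thetaExponent_nonneg (r := 5 * r) (hg₁ c).1 (hg₁ c).2 a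
  have exp₂ := thetaExponent_nonneg (r := 5 * r) (hg₂ c).1 (hg₂ c).2 b
  dsimp only [gaussEquiv, Equiv.coe_fn_mk]
  rw [qPow_mul_qPow _ _ (exp_k _) (exp_l _), qPow_mul_qPow _ _ exp₁ exp₂,
    qPow_mul_qPow _ _ (add_nonneg (exp_k _) (exp_l _)) (add_nonneg exp₁ exp₂), ← zpow_add,
    ← zpow_add, ← zpow_add]
  congr 1
  · rw [← mul_one (ε ^ ((g c).1 + _ + _)), ← units_zpow_two_mul ε b, ← zpow_add]
    congr 1
    ring
  · ring

theorem thetaSeries_one_one_sq (ε : ℤˣ) :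
    Θ 1 1 ε ^ 2 = Θ 5 5 ε ^ 2 + 4 * (qPow ε 1 * Θ 5 1 ε * Θ 5 3 ε) := by
  have gauss := thetaSeries_mul_thetaSeries_gauss (r := 1) (k := 1) (l := 1) one_pos (by norm_num)
    (by norm_num) (by norm_num) (by norm_num) ε ![(0, 0), (1, 0), (0, 1), (0, -1), (-1, 0)]
    (by simp [Fin.forall_fin_succ]) (by simp [Fin.forall_fin_succ]) (by simp [Fin.forall_fin_succ])
  have reflect_nine : Θ 5 9 ε = Θ 5 1 ε := thetaSeries_reflect 5 1 ε
  have reflect_seven : Θ 5 7 ε = Θ 5 3 ε := thetaSeries_reflect 5 3 ε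
  rw [pow_two, gauss, Fin.sum_univ_five]
  simp only [Int.reduceNeg, Fin.isValue, Matrix.cons_val_zero, add_zero, zpow_ofNat, pow_zero,
    zero_sub, mul_neg, mul_one, neg_zero, mul_zero, qPow_one_zero, sub_self, zero_add,
    Int.reduceMul, Int.reduceAdd, Int.reduceSub, one_mul, Matrix.cons_val_one, pow_one, sub_zero,
    reflect_nine, reflect_seven, Matrix.cons_val, zpow_neg, Int.units_inv_eq_self, neg_mul,
    neg_neg, sub_neg_eq_add, neg_add_cancel]
  ring

theorem thetaSeries_four_two_sq :
    Θ 4 2 1 ^ 2 = X ^ 2 * Θ 20 10 1 ^ 2 + Θ 5 2 1 * Θ 5 4 1 := by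
  have gauss := thetaSeries_mul_thetaSeries_gauss (r := 4) (k := 6) (l := 2) (by norm_num)
    (by norm_num) (by norm_num) (by norm_num) (by norm_num) 1
    ![(0, 0), (-1, 1), (0, 1), (0, -1), (-1, 0)]
    (by simp [Fin.forall_fin_succ]) (by simp [Fin.forall_fin_succ]) (by simp [Fin.forall_fin_succ])
  have split_two := thetaSeries_eq_even_add_odd (r := 5) (k := 2)
    (by norm_num) (by norm_num) (by norm_num) 1
  have split_four := thetaSeries_eq_even_add_odd (r := 5) (k := 4)
    (by norm_num) (by norm_num) (by norm_num) 1
  have reflect_six : Θ 4 6 1 = Θ 4 2 1 := thetaSeries_reflect 4 2 1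
  have reflect_26 : Θ 20 26 1 = Θ 20 14 1 := thetaSeries_reflect 20 14 1
  have reflect_38 : Θ 20 38 1 = Θ 20 2 1 := thetaSeries_reflect 20 2 1
  norm_num [reflect_38] at split_two split_four
  rw [reflect_six, Fin.sum_univ_five] at gauss
  rw [split_two, split_four, pow_two, gauss]
  simp only [qPow, Int.reduceNeg, Fin.isValue, Matrix.cons_val_zero, add_zero, zpow_ofNat,
    pow_zero, Units.val_one, Int.cast_one, zero_sub, mul_neg, mul_one, neg_zero, mul_zero,
    Int.toNat_zero, Int.reduceMul, sub_self, zero_add, Int.reduceAdd, Int.reduceSub, reflect_26,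
    one_mul, Matrix.cons_val_one, neg_add_cancel, neg_mul, neg_neg, Int.reduceToNat,
    Matrix.cons_val, one_pow, zpow_neg, inv_one, sub_neg_eq_add, sub_zero]
  ring

/-! ### Gaussian binomial coefficients -/

section GaussBinom

variable {A B : Type*} [CommRing A] [CommRing B]

/-- The Gaussian binomial coefficients, defined by the `q`-Pascal rule. -/
def gaussBinom (Q : A) : ℕ → ℕ → A
  | _, 0 => 1
  | 0, _ + 1 => 0
  | n + 1, k + 1 => Q ^ (k + 1) * gaussBinom Q n (k + 1) + gaussBinom Q n k

/-- The finite product `(Q; Q)_n`. -/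
def qPoch (Q : A) (n : ℕ) : A := ∏ i ∈ Finset.range n, (1 - Q ^ (i + 1))

theorem qPoch_succ (Q : A) (n : ℕ) : qPoch Q (n + 1) = qPoch Q n * (1 - Q ^ (n + 1)) :=
  Finset.prod_range_succ ..

@[simp] theorem gaussBinom_zero_right (Q : A) (n : ℕ) : gaussBinom Q n 0 = 1 := by
  cases n <;> rfl

theorem gaussBinom_succ_succ (Q : A) (n k : ℕ) :
    gaussBinom Q (n + 1) (k + 1) = Q ^ (k + 1) * gaussBinom Q n (k + 1) + gaussBinom Q n k := rfl

theorem gaussBinom_eq_zero (Q : A) {n k : ℕ} (h : n < k) : gaussBinom Q n k = 0 := by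
  obtain ⟨k, rfl⟩ := Nat.exists_eq_add_one_of_ne_zero (Nat.ne_zero_of_lt h)
  induction n generalizing k with
  | zero => rfl
  | succ n ih =>
    obtain ⟨k, rfl⟩ := Nat.exists_eq_add_one_of_ne_zero (n := k) (by lia)
    rw [gaussBinom_succ_succ, ih (k + 1) (by lia), ih k (by lia), mul_zero, add_zero]

theorem gaussBinom_self (Q : A) (n : ℕ) : gaussBinom Q n n = 1 := by
  induction n with
  | zero => rfl
  | succ n ih =>
    rw [gaussBinom_succ_succ, gaussBinom_eq_zero Q n.lt_succ_self, ih, mul_zero, zero_add]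

theorem map_gaussBinom (f : A →+* B) (Q : A) (n k : ℕ) :
    f (gaussBinom Q n k) = gaussBinom (f Q) n k := by
  induction n generalizing k with
  | zero => cases k <;> simp [gaussBinom]
  | succ n ih => cases k <;> simp [gaussBinom, ih]

theorem map_qPoch (f : A →+* B) (Q : A) (n : ℕ) : f (qPoch Q n) = qPoch (f Q) n := by
  simp [qPoch]

theorem gaussBinom_add_mul_qPoch (Q : A) (a b : ℕ) :
    gaussBinom Q (a + b) a * (qPoch Q a * qPoch Q b) = qPoch Q (a + b) := by
  induction hn : a + b generalizing a b with
  | zero =>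
    obtain ⟨rfl, rfl⟩ := Nat.add_eq_zero_iff.mp hn
    simp [qPoch]
  | succ n ih =>
    rcases a with _ | a
    · obtain rfl : b = n + 1 := by lia
      simp [qPoch]
    rcases b with _ | b
    · obtain rfl : a = n := by lia
      simp [gaussBinom_self, qPoch]
    have ih_left := ih (a + 1) b (by lia)
    have ih_right := ih a (b + 1) (by lia)
    obtain rfl : n = a + b + 1 := by lia
    rw [gaussBinom_succ_succ]
    rw [qPoch_succ Q a] at ih_left ⊢
    rw [qPoch_succ Q b] at ih_right ⊢
    rw [qPoch_succ Q (a + b + 1)]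
    linear_combination Q ^ (a + 1) * (1 - Q ^ (b + 1)) * ih_left + (1 - Q ^ (a + 1)) * ih_right

/-- The `q`-binomial theorem. -/
theorem prod_one_add_mul_pow (Q t : A) (M : ℕ) :
    ∏ i ∈ Finset.range M, (1 + t * Q ^ i) =
      ∑ i ∈ Finset.range (M + 1), Q ^ i.choose 2 * gaussBinom Q M i * t ^ i := by
  induction M generalizing t with
  | zero => simp
  | succ M ih =>
    have factor_succ : ∀ i, 1 + t * Q ^ (i + 1) = 1 + (t * Q) * Q ^ i := fun i => by ring
    have term_succ : ∀ i, Q ^ (i + 1).choose 2 * gaussBinom Q (M + 1) (i + 1) * t ^ (i + 1) =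
        Q ^ (i + 1).choose 2 * gaussBinom Q M (i + 1) * (t * Q) ^ (i + 1) +
          t * (Q ^ i.choose 2 * gaussBinom Q M i * (t * Q) ^ i) := by
      intro i
      rw [gaussBinom_succ_succ, Nat.choose_succ_succ' i 1, Nat.choose_one_right]
      ring
    have shift := Finset.sum_range_succ'
      (fun i => Q ^ i.choose 2 * gaussBinom Q M i * (t * Q) ^ i) (M + 1)
    rw [Finset.sum_range_succ, gaussBinom_eq_zero Q M.lt_succ_self] at shift
    rw [Finset.prod_range_succ', Finset.prod_congr rfl fun i _ => factor_succ i, ih,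
      Finset.sum_range_succ' _ (M + 1)]
    simp only [term_succ, Finset.sum_add_distrib, ← Finset.mul_sum]
    simp only [gaussBinom_zero_right, pow_zero, mul_zero, zero_mul, add_zero, mul_one] at shift ⊢
    linear_combination shift

end GaussBinom

section PartialFractions

variable {K : Type*} [Field K] {Q : K}

/-- The partial fraction expansion of `y^j (Q; Q)_M / ∏ (1 - y Q^i)`, the product being over
`0 ≤ i ≤ M`; see `gaussFractionSum_eq`. -/
def gaussFractionSum (Q y : K) (M j : ℕ) : K :=
  ∑ i ∈ Finset.range (M + 1), (-1) ^ i * gaussBinom Q M i * Q ^ (i + 1).choose 2 *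
    (Q ^ (i * j))⁻¹ / (1 - y * Q ^ i)

theorem gaussFractionSum_succ_succ (hQ : Q ≠ 0) (y : K) (M j : ℕ) :
    gaussFractionSum Q y (M + 1) (j + 1) =
      gaussFractionSum Q y M j - (Q ^ j)⁻¹ * gaussFractionSum Q (y * Q) M j := by
  have term_succ : ∀ i : ℕ, (-1) ^ (i + 1) * gaussBinom Q (M + 1) (i + 1) *
      Q ^ (i + 1 + 1).choose 2 * (Q ^ ((i + 1) * (j + 1)))⁻¹ / (1 - y * Q ^ (i + 1)) =
        (-1) ^ (i + 1) * gaussBinom Q M (i + 1) * Q ^ (i + 1 + 1).choose 2 *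
            (Q ^ ((i + 1) * j))⁻¹ / (1 - y * Q ^ (i + 1)) -
          (Q ^ j)⁻¹ * ((-1) ^ i * gaussBinom Q M i * Q ^ (i + 1).choose 2 * (Q ^ (i * j))⁻¹ /
            (1 - y * Q * Q ^ i)) := by
    intro i
    rw [gaussBinom_succ_succ, Nat.choose_succ_succ' (i + 1) 1, Nat.choose_one_right,
      show y * Q * Q ^ i = y * Q ^ (i + 1) by ring]
    generalize 1 - y * Q ^ (i + 1) = c
    field_simp
    ring
  have shift := Finset.sum_range_succ' (fun i => (-1) ^ i * gaussBinom Q M i *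
    Q ^ (i + 1).choose 2 * (Q ^ (i * j))⁻¹ / (1 - y * Q ^ i)) (M + 1)
  rw [Finset.sum_range_succ, gaussBinom_eq_zero Q M.lt_succ_self] at shift
  unfold gaussFractionSum
  rw [Finset.sum_range_succ', Finset.sum_congr rfl fun i _ => term_succ i,
    Finset.sum_sub_distrib, ← Finset.mul_sum]
  simp only [mul_zero, zero_mul, zero_div, add_zero, gaussBinom_zero_right, pow_zero] at shift ⊢
  linear_combination -shift

/-- The difference of the two sides is a multiple of the `q`-binomial sum at `-Q^{-j}`, which
vanishes. -/
theorem gaussFractionSum_succ_right (hQ : Q ≠ 0) {y : K} (hy : ∀ i : ℕ, 1 - y * Q ^ i ≠ 0)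
    {M j : ℕ} (hj : j < M) : gaussFractionSum Q y M (j + 1) = y * gaussFractionSum Q y M j := by
  have binomial_sum_eq_zero : ∑ i ∈ Finset.range (M + 1), (-1) ^ i * gaussBinom Q M i *
      Q ^ (i + 1).choose 2 * (Q ^ (i * (j + 1)))⁻¹ = 0 := by
    rw [← Finset.prod_eq_zero (f := fun i => 1 + -(Q ^ j)⁻¹ * Q ^ i) (Finset.mem_range.mpr hj)
      (by field_simp; ring), prod_one_add_mul_pow]
    refine Finset.sum_congr rfl fun i _ => ?_
    rw [Nat.choose_succ_succ' i 1, Nat.choose_one_right, neg_pow (Q ^ j)⁻¹, inv_pow, ← pow_mul,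
      mul_comm j i]
    field_simp
    ring
  unfold gaussFractionSum
  rw [← sub_eq_zero, ← binomial_sum_eq_zero, Finset.mul_sum, ← Finset.sum_sub_distrib]
  refine Finset.sum_congr rfl fun i _ => ?_
  have := hy i
  field_simp
  ring

theorem gaussFractionSum_eq (hQ : Q ≠ 0) {y : K} (hy0 : y ≠ 0) (hy : ∀ i : ℕ, 1 - y * Q ^ i ≠ 0)
    {M j : ℕ} (hj : j ≤ M) :
    gaussFractionSum Q y M j = y ^ j * qPoch Q M / ∏ i ∈ Finset.range (M + 1), (1 - y * Q ^ i) := by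
  induction M generalizing y j with
  | zero =>
    obtain rfl := Nat.le_zero.mp hj
    simp [gaussFractionSum, qPoch]
  | succ M ih =>
    have hy' : ∀ i : ℕ, 1 - y * Q * Q ^ i ≠ 0 := fun i => by
      rw [mul_assoc, ← pow_succ']
      exact hy (i + 1)
    have eq_succ {j : ℕ} (hj : j ≤ M) : gaussFractionSum Q y (M + 1) (j + 1) =
        y ^ (j + 1) * qPoch Q (M + 1) / ∏ i ∈ Finset.range (M + 1 + 1), (1 - y * Q ^ i) := by
      have prod_zero := Finset.prod_range_succ' (fun i => 1 - y * Q ^ i) (M + 1)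
      have prod_last := Finset.prod_range_succ (fun i => 1 - y * Q ^ i) (M + 1)
      have prod_shift : ∏ i ∈ Finset.range (M + 1), (1 - y * Q * Q ^ i) =
          ∏ i ∈ Finset.range (M + 1), (1 - y * Q ^ (i + 1)) :=
        Finset.prod_congr rfl fun i _ => by ring
      have prod_ne : ∏ i ∈ Finset.range (M + 1), (1 - y * Q ^ i) ≠ 0 :=
        Finset.prod_ne_zero_iff.mpr fun i _ => hy i
      have prod_shift_ne : ∏ i ∈ Finset.range (M + 1), (1 - y * Q ^ (i + 1)) ≠ 0 :=
        Finset.prod_ne_zero_iff.mpr fun i _ => hy _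
      have last_ne := hy (M + 1)
      rw [gaussFractionSum_succ_succ hQ, ih hy0 hy hj, ih (mul_ne_zero hy0 hQ) hy' hj, prod_shift,
        prod_last, qPoch_succ]
      rw [prod_last, pow_zero, mul_one] at prod_zero
      field_simp
      linear_combination -(qPoch Q M * y ^ j * Q ^ j) * prod_zero
    rcases j with _ | j
    · refine mul_left_cancel₀ hy0 ?_
      rw [← gaussFractionSum_succ_right hQ hy M.succ_pos, eq_succ M.zero_le]
      ring
    · exact eq_succ (Nat.le_of_succ_le_succ hj)

end PartialFractions

section SymmetricForms

variable {K : Type*} [Field K] {x w z : K}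

theorem two_mul_choose_two (i : ℕ) : (2 * i.choose 2 : ℤ) = i * (i - 1) := by
  induction i with
  | zero => rfl
  | succ i ih =>
    rw [Nat.choose_succ_succ' i 1, Nat.choose_one_right]
    push_cast
    linear_combination ih

theorem sq_pow_choose_two (x : K) (i : ℕ) : (x ^ 2) ^ i.choose 2 = x ^ ((i : ℤ) * (i - 1)) := by
  rw [← pow_mul, ← two_mul_choose_two, ← zpow_natCast]
  push_cast
  rfl

theorem zpow_neg_two_mul_mul_sq_pow (hx : x ≠ 0) (N : ℕ) :
    x ^ (-(2 * N) : ℤ) * (x ^ 2) ^ N = 1 := by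
  rw [zpow_neg, zpow_mul, zpow_ofNat, zpow_natCast, inv_mul_cancel₀ (by positivity)]

theorem prod_mul_zpow_neg_two_mul (hx : x ≠ 0) (w : K) (N : ℕ) :
    ∏ i ∈ Finset.range N, (w * x ^ (-(2 * (i + 1)) : ℤ)) =
      w ^ N * x ^ (-(N * (N + 1)) : ℤ) := by
  induction N with
  | zero => simp
  | succ N ih =>
    rw [Finset.prod_range_succ, ih, pow_succ, mul_mul_mul_comm, ← zpow_add₀ hx]
    congr 2
    push_cast
    ring

theorem prod_range_two_mul (hx : x ≠ 0) (hw : w ≠ 0) (N : ℕ) :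
    ∏ i ∈ Finset.range (2 * N), (1 + w * x ^ (-(2 * N) : ℤ) * (x ^ 2) ^ i) =
      w ^ N * x ^ (-(N * (N + 1)) : ℤ) * ((∏ i ∈ Finset.range N, (1 + w * (x ^ 2) ^ i)) *
        ∏ i ∈ Finset.range N, (1 + w⁻¹ * (x ^ 2) ^ (i + 1))) := by
  have lower_half : ∏ i ∈ Finset.range N, (1 + w * x ^ (-(2 * N) : ℤ) * (x ^ 2) ^ i) =
      w ^ N * x ^ (-(N * (N + 1)) : ℤ) *
        ∏ i ∈ Finset.range N, (1 + w⁻¹ * (x ^ 2) ^ (i + 1)) := by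
    rw [← prod_mul_zpow_neg_two_mul hx, ← Finset.prod_mul_distrib, ← Finset.prod_range_reflect]
    refine Finset.prod_congr rfl fun i hi => ?_
    have hN : N = i + 1 + (N - 1 - i) := by
      have := Finset.mem_range.mp hi
      lia
    have cancel := zpow_neg_two_mul_mul_sq_pow hx (i + 1)
    have cancel' := zpow_neg_two_mul_mul_sq_pow hx (N - 1 - i)
    have split : x ^ (-(2 * N) : ℤ) =
        x ^ (-(2 * (i + 1 : ℕ)) : ℤ) * x ^ (-(2 * (N - 1 - i : ℕ)) : ℤ) := by
      rw [← zpow_add₀ hx]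
      congr 1
      lia
    rw [split]
    push_cast at cancel ⊢
    linear_combination w * x ^ (-(2 * (i + 1)) : ℤ) * cancel' -
      x ^ (-(2 * (i + 1)) : ℤ) * (x ^ 2) ^ (i + 1) * mul_inv_cancel₀ hw - cancel
  have upper_half : ∏ i ∈ Finset.range N, (1 + w * x ^ (-(2 * N) : ℤ) * (x ^ 2) ^ (N + i)) =
      ∏ i ∈ Finset.range N, (1 + w * (x ^ 2) ^ i) :=
    Finset.prod_congr rfl fun i _ => by
      linear_combination w * (x ^ 2) ^ i * zpow_neg_two_mul_mul_sq_pow hx N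
  rw [two_mul, Finset.prod_range_add, lower_half, upper_half]
  ring

theorem finite_triple_product (hx : x ≠ 0) (hw : w ≠ 0) (N : ℕ) :
    (∏ i ∈ Finset.range N, (1 + w * (x ^ 2) ^ i)) *
        ∏ i ∈ Finset.range N, (1 + w⁻¹ * (x ^ 2) ^ (i + 1)) =
      ∑ i ∈ Finset.range (2 * N + 1), gaussBinom (x ^ 2) (2 * N) i *
        (x ^ (((i : ℤ) - N) * (((i : ℤ) - N) - 1)) * w ^ ((i : ℤ) - N)) := by
  have factor_ne : w ^ N * x ^ (-(N * (N + 1)) : ℤ) ≠ 0 := by positivity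
  refine mul_left_cancel₀ factor_ne ?_
  rw [← prod_range_two_mul hx hw, prod_one_add_mul_pow, Finset.mul_sum]
  refine Finset.sum_congr rfl fun i _ => ?_
  have w_pow : w ^ i = w ^ N * w ^ ((i : ℤ) - N) := by
    rw [← zpow_natCast w N, ← zpow_add₀ hw, add_sub_cancel, zpow_natCast]
  have x_pow : x ^ ((i : ℤ) * (i - 1)) * x ^ (-(2 * N) * i : ℤ) =
      x ^ (-(N * (N + 1)) : ℤ) * x ^ (((i : ℤ) - N) * (((i : ℤ) - N) - 1)) := by
    rw [← zpow_add₀ hx, ← zpow_add₀ hx]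
    congr 1
    ring
  rw [mul_pow, sq_pow_choose_two, ← zpow_natCast (x ^ _) i, ← zpow_mul, w_pow]
  linear_combination gaussBinom (x ^ 2) (2 * N) i * w ^ N * w ^ ((i : ℤ) - N) * x_pow

theorem one_sub_mul_zpow_two_mul_sub (hx : x ≠ 0) (z : K) (i N : ℕ) :
    1 - z * x ^ (2 * ((i : ℤ) - N)) = 1 - z * x ^ (-(2 * N) : ℤ) * (x ^ 2) ^ i := by
  rw [mul_assoc, ← zpow_natCast (x ^ 2), ← zpow_natCast x 2, ← zpow_mul, ← zpow_add₀ hx]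
  congr 3
  push_cast
  ring

theorem gaussFractionSum_two_mul (hx : x ≠ 0) (z : K) (N : ℕ) :
    gaussFractionSum (x ^ 2) (z * x ^ (-(2 * N) : ℤ)) (2 * N) N =
      (-1) ^ N * x ^ (N - N * N : ℤ) * ∑ i ∈ Finset.range (2 * N + 1),
        gaussBinom (x ^ 2) (2 * N) i * ((-1) ^ ((i : ℤ) - N) *
          x ^ (((i : ℤ) - N) * (((i : ℤ) - N) + 1)) * (1 - z * x ^ (2 * ((i : ℤ) - N)))⁻¹) := by
  unfold gaussFractionSum
  rw [Finset.mul_sum]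
  refine Finset.sum_congr rfl fun i _ => ?_
  have sign : (-1 : K) ^ i = (-1) ^ N * (-1) ^ ((i : ℤ) - N) := by
    rw [← zpow_natCast _ N, ← zpow_add₀ (by norm_num), add_sub_cancel, zpow_natCast]
  have x_inv : ((x ^ 2) ^ (i * N))⁻¹ = x ^ (-(2 * (i * N)) : ℤ) := by
    rw [← pow_mul, zpow_neg, ← zpow_natCast]
    push_cast
    rfl
  have x_pow : x ^ (((i + 1 : ℕ) : ℤ) * ((i + 1 : ℕ) - 1)) * x ^ (-(2 * (i * N)) : ℤ) =
      x ^ (N - N * N : ℤ) * x ^ (((i : ℤ) - N) * (((i : ℤ) - N) + 1)) := by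
    rw [← zpow_add₀ hx, ← zpow_add₀ hx]
    congr 1
    push_cast
    ring
  rw [one_sub_mul_zpow_two_mul_sub hx, sq_pow_choose_two, x_inv, sign, mul_assoc _ (x ^ _), x_pow]
  ring

theorem finite_partial_fractions (hx : x ≠ 0) (hz : z ≠ 0) (h : ∀ n : ℤ, 1 - z * x ^ (2 * n) ≠ 0)
    (N : ℕ) :
    ((∏ i ∈ Finset.range N, (1 + -z * (x ^ 2) ^ i)) *
        ∏ i ∈ Finset.range N, (1 + (-z)⁻¹ * (x ^ 2) ^ (i + 1))) * (1 - z * (x ^ 2) ^ N) *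
      ∑ i ∈ Finset.range (2 * N + 1), gaussBinom (x ^ 2) (2 * N) i * ((-1) ^ ((i : ℤ) - N) *
        x ^ (((i : ℤ) - N) * (((i : ℤ) - N) + 1)) * (1 - z * x ^ (2 * ((i : ℤ) - N)))⁻¹) =
      qPoch (x ^ 2) (2 * N) := by
  set y := z * x ^ (-(2 * N) : ℤ) with hy
  have factor_ne : ∀ i : ℕ, 1 - y * (x ^ 2) ^ i ≠ 0 := fun i =>
    one_sub_mul_zpow_two_mul_sub hx z i N ▸ h _
  have prod_eq : ∏ i ∈ Finset.range (2 * N + 1), (1 - y * (x ^ 2) ^ i) =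
      (-z) ^ N * x ^ (-(N * (N + 1)) : ℤ) * ((∏ i ∈ Finset.range N, (1 + -z * (x ^ 2) ^ i)) *
        ∏ i ∈ Finset.range N, (1 + (-z)⁻¹ * (x ^ 2) ^ (i + 1))) * (1 - z * (x ^ 2) ^ N) := by
    rw [Finset.prod_range_succ, ← prod_range_two_mul hx (neg_ne_zero.mpr hz)]
    congr 1
    · exact Finset.prod_congr rfl fun i _ => by ring
    · linear_combination -(z * (x ^ 2) ^ N) * zpow_neg_two_mul_mul_sq_pow hx N
  have eval := gaussFractionSum_eq (pow_ne_zero 2 hx) (mul_ne_zero hz (zpow_ne_zero _ hx)) factor_ne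
    (show N ≤ 2 * N by lia)
  rw [← hy, eq_div_iff (Finset.prod_ne_zero_iff.mpr fun i _ => factor_ne i), prod_eq,
    gaussFractionSum_two_mul hx] at eval
  have y_pow : y ^ N = (-1) ^ N * x ^ (N - N * N : ℤ) * ((-z) ^ N * x ^ (-(N * (N + 1)) : ℤ)) := by
    rw [hy, mul_pow, ← zpow_natCast (x ^ _) N, ← zpow_mul, mul_mul_mul_comm, ← mul_pow,
      neg_one_mul, neg_neg, ← zpow_add₀ hx]
    congr 2
    ring
  have y_pow_ne : y ^ N ≠ 0 := pow_ne_zero N (mul_ne_zero hz (zpow_ne_zero _ hx))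
  refine mul_left_cancel₀ y_pow_ne ?_
  rw [← eval, y_pow]
  ring

end SymmetricForms

/-! ### The triple product and the reciprocal of a theta series -/

section Limits

theorem tendsto_iff_X_pow_dvd {R ι : Type*} [CommRing R] [TopologicalSpace R] [DiscreteTopology R]
    {l : Filter ι} {u : ι → R⟦X⟧} {v : R⟦X⟧} :
    Tendsto u l (𝓝 v) ↔ ∀ d : ℕ, ∀ᶠ n in l, X ^ d ∣ u n - v := by
  rw [WithPiTopology.tendsto_iff_coeff_tendsto]
  simp only [nhds_discrete, tendsto_pure, X_pow_dvd_iff, map_sub, sub_eq_zero]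
  refine ⟨fun h d => ?_, fun h d => (h (d + 1)).mono fun n hn => hn d d.lt_succ_self⟩
  simpa only [Finset.mem_range] using
    (eventually_all_finset (Finset.range d)).mpr fun i _ => h i

theorem tendsto_prod_qPochInf (a : ℤ⟦X⟧) {u : ℤ⟦X⟧} (hu : constantCoeff u = 0) :
    Tendsto (fun N => ∏ i ∈ Finset.range N, (1 - a * u ^ i)) atTop (𝓝 (qPochInf a u)) :=
  (multipliable_qPochInf a hu).tendsto_prod_tprod_nat

theorem tendsto_qPoch {q : ℤ⟦X⟧} (hq : constantCoeff q = 0) :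
    Tendsto (qPoch q) atTop (𝓝 (qPochInf q q)) :=
  (tendsto_prod_qPochInf q hq).congr fun _ => Finset.prod_congr rfl fun _ _ => by rw [pow_succ']

theorem isUnit_qPochInf {a u : ℤ⟦X⟧} (ha : constantCoeff a = 0) (hu : constantCoeff u = 0) :
    IsUnit (qPochInf a u) := isUnit_of_constantCoeff_eq_one (constantCoeff_qPochInf ha hu)

theorem tendsto_gaussBinom {q : ℤ⟦X⟧} (hq : constantCoeff q = 0) (n : ℤ) :
    Tendsto (fun N : ℕ => qPochInf q q * gaussBinom q (2 * N) (n + N).toNat) atTop (𝓝 1) := by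
  have tendsto_qPoch_comp {b : ℕ → ℕ} (hb : ∀ N, N ≤ b N + n.natAbs) :
      Tendsto (fun N => qPoch q (b N)) atTop (𝓝 (qPochInf q q)) :=
    (tendsto_qPoch hq).comp <| tendsto_atTop.mpr fun c =>
      eventually_atTop.mpr ⟨c + n.natAbs, fun N hN => by have := hb N; lia⟩
  have h_add := tendsto_qPoch_comp (b := fun N => (n + N).toNat) fun N => by lia
  have h_sub := tendsto_qPoch_comp (b := fun N => (N - n).toNat) fun N => by lia
  have h_two_mul := tendsto_qPoch_comp (b := fun N => 2 * N) fun N => by lia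
  rw [tendsto_iff_X_pow_dvd] at h_add h_sub h_two_mul ⊢
  intro d
  filter_upwards [h_add d, h_sub d, h_two_mul d, eventually_ge_atTop n.natAbs]
    with N hA hB hC hN
  have hG := gaussBinom_add_mul_qPoch q (n + N).toNat (N - n).toNat
  rw [show (n + N).toNat + (N - n).toNat = 2 * N by lia] at hG
  set G := gaussBinom q (2 * N) (n + N).toNat
  have hP := isUnit_qPochInf hq hq
  set P := qPochInf q q
  set A := qPoch q (n + N).toNat
  set B := qPoch q (N - n).toNat
  set C := qPoch q (2 * N)
  have eq_combination : P * (P * G - 1) = (C - P) - G * A * (B - P) - G * P * (A - P) := by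
    linear_combination hG
  rw [← hP.dvd_mul_left, eq_combination]
  exact (hC.sub (hB.mul_left _)).sub (hA.mul_left _)

theorem tendsto_sum_gaussBinom {q : ℤ⟦X⟧} (hq : constantCoeff q = 0) {v : ℤ → ℤ⟦X⟧}
    (hv : IsNullFamily v) :
    Tendsto (fun N : ℕ => qPochInf q q * ∑ n ∈ Finset.Icc (-N : ℤ) N,
      gaussBinom q (2 * N) (n + N).toNat * v n) atTop (𝓝 (∑' n, v n)) := by
  simp only [Finset.mul_sum, ← mul_assoc]
  refine hv.tendsto_sum (u := fun N n => _ * v n) (fun _ _ => dvd_mul_left ..) (fun _ => dvd_rfl)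
    (fun n => by simpa only [one_mul] using (tendsto_gaussBinom hq n).mul_const (v n)) _
    fun n => eventually_atTop.mpr ⟨n.natAbs, fun N hN => ?_⟩
  rw [Finset.mem_Icc]
  lia

theorem sum_range_two_mul_add_one {M : Type*} [AddCommMonoid M] (F : ℕ → ℤ → M) (N : ℕ) :
    ∑ i ∈ Finset.range (2 * N + 1), F i ((i : ℤ) - N) =
      ∑ n ∈ Finset.Icc (-N : ℤ) N, F (n + N).toNat n := by
  refine Finset.sum_nbij' (fun i => (i : ℤ) - N) (fun n => (n + N).toNat) ?_ ?_ ?_ ?_ ?_ <;>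
    simp only [Finset.mem_range, Finset.mem_Icc, sub_add_cancel, Int.toNat_natCast,
      implies_true] <;>
    lia

end Limits

section FractionField

variable {K : Type*} [Field K]

theorem units_cast_mul_self (ε : ℤˣ) : ((ε : ℤ) : K) * ((ε : ℤ) : K) = 1 := by
  rw [← Int.cast_mul, Int.units_coe_mul_self, Int.cast_one]

theorem units_cast_ne_zero (ε : ℤˣ) : ((ε : ℤ) : K) ≠ 0 :=
  left_ne_zero_of_mul_eq_one (units_cast_mul_self ε)

theorem units_cast_inv (ε : ℤˣ) : ((ε : ℤ) : K)⁻¹ = ((ε : ℤ) : K) :=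
  inv_eq_of_mul_eq_one_left (units_cast_mul_self ε)

theorem units_cast_zpow (ε : ℤˣ) (n : ℤ) : (((ε ^ n : ℤˣ) : ℤ) : K) = ((ε : ℤ) : K) ^ n :=
  (congrArg Units.val (map_zpow (Units.map (Int.castRingHom K : ℤ →* K)) ε n)).trans
    (Units.val_zpow_eq_zpow_val _ n)

theorem map_qPow (φ : ℤ⟦X⟧ →+* K) (ε : ℤˣ) {a : ℤ} (ha : 0 ≤ a) :
    φ (qPow ε a) = ((ε : ℤ) : K) * φ X ^ a := by
  obtain ⟨n, rfl⟩ := Int.eq_ofNat_of_zero_le ha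
  simp [qPow]

theorem map_qPow_two_mul (φ : ℤ⟦X⟧ →+* K) {r : ℤ} (hr : 0 ≤ r) :
    φ (qPow 1 (2 * r)) = (φ X ^ r) ^ 2 := by
  rw [map_qPow φ 1 (by lia), mul_comm 2, zpow_mul, zpow_ofNat]
  simp

theorem map_prod_one_add (φ : ℤ⟦X⟧ →+* K) {r k : ℤ} (hr : 0 ≤ r) (hk : 0 ≤ k) (ε : ℤˣ) (N : ℕ) :
    φ (∏ i ∈ Finset.range N, (1 + qPow ε k * qPow 1 (2 * r) ^ i)) =
      ∏ i ∈ Finset.range N, (1 + ((ε : ℤ) : K) * φ X ^ k * ((φ X ^ r) ^ 2) ^ i) := by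
  simp only [map_prod, map_add, map_one, map_mul, map_pow, map_qPow_two_mul φ hr, map_qPow φ ε hk]

theorem map_prod_one_add_reflect (φ : ℤ⟦X⟧ →+* K) (hX : φ X ≠ 0) {r k : ℤ} (hr : 0 ≤ r)
    (hk : k ≤ 2 * r) (ε : ℤˣ) (N : ℕ) :
    φ (∏ i ∈ Finset.range N, (1 + qPow ε (2 * r - k) * qPow 1 (2 * r) ^ i)) =
      ∏ i ∈ Finset.range N,
        (1 + (((ε : ℤ) : K) * φ X ^ k)⁻¹ * ((φ X ^ r) ^ 2) ^ (i + 1)) := by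
  rw [map_prod_one_add φ hr (by lia)]
  refine Finset.prod_congr rfl fun i _ => ?_
  rw [mul_inv, units_cast_inv, pow_succ, zpow_sub₀ hX, mul_comm 2, zpow_mul, zpow_ofNat,
    div_eq_mul_inv]
  ring

theorem algebraMap_X_ne_zero : algebraMap ℤ⟦X⟧ (FractionRing ℤ⟦X⟧) X ≠ 0 := by
  simp

end FractionField

theorem constantCoeff_qPow (ε : ℤˣ) {a : ℤ} (ha : 0 < a) : constantCoeff (qPow ε a) = 0 := by
  simp [qPow, show a.toNat ≠ 0 by lia]

theorem finite_triple_product_qPow {r k : ℤ} (hk : 0 ≤ k) (hkr : k ≤ 2 * r) (ε : ℤˣ) (N : ℕ) :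
    (∏ i ∈ Finset.range N, (1 + qPow ε k * qPow 1 (2 * r) ^ i)) *
        ∏ i ∈ Finset.range N, (1 + qPow ε (2 * r - k) * qPow 1 (2 * r) ^ i) =
      ∑ n ∈ Finset.Icc (-N : ℤ) N, gaussBinom (qPow 1 (2 * r)) (2 * N) (n + N).toNat *
        qPow (ε ^ n) (r * (n * (n - 1)) + k * n) := by
  have hr : 0 ≤ r := by lia
  have hX := algebraMap_X_ne_zero
  refine IsFractionRing.injective ℤ⟦X⟧ (FractionRing ℤ⟦X⟧) ?_
  set φ := algebraMap ℤ⟦X⟧ (FractionRing ℤ⟦X⟧)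
  rw [map_mul, map_prod_one_add φ hr hk, map_prod_one_add_reflect φ hX hr hkr,
    finite_triple_product (zpow_ne_zero _ hX)
      (mul_ne_zero (units_cast_ne_zero ε) (zpow_ne_zero _ hX)), map_sum,
    sum_range_two_mul_add_one fun i n => gaussBinom ((φ X ^ r) ^ 2) (2 * N) i *
      ((φ X ^ r) ^ (n * (n - 1)) * (((ε : ℤ) : FractionRing ℤ⟦X⟧) * φ X ^ k) ^ n)]
  refine Finset.sum_congr rfl fun n _ => ?_
  rw [map_mul, map_gaussBinom, map_qPow_two_mul φ hr, map_qPow φ _ (thetaExponent_nonneg hk hkr n),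
    units_cast_zpow, mul_zpow, zpow_add₀ hX, ← zpow_mul, ← zpow_mul]
  ring

theorem tendsto_prod_one_add_qPow {r : ℤ} (h0 : 0 < r) (k : ℤ) (ε : ℤˣ) :
    Tendsto (fun N : ℕ => ∏ i ∈ Finset.range N, (1 + qPow ε k * qPow 1 (2 * r) ^ i)) atTop
      (𝓝 (qPochInf (-qPow ε k) (qPow 1 (2 * r)))) := by
  simpa only [neg_mul, sub_neg_eq_add] using
    tendsto_prod_qPochInf (-qPow ε k) (constantCoeff_qPow 1 (show 0 < 2 * r by lia))

/-- Jacobi's triple product identity. -/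
theorem qPochInf_mul_eq_thetaSeries {r k : ℤ} (h0 : 0 < r) (hk : 0 ≤ k) (hkr : k ≤ 2 * r)
    (ε : ℤˣ) :
    qPochInf (-qPow ε k) (qPow 1 (2 * r)) * qPochInf (-qPow ε (2 * r - k)) (qPow 1 (2 * r)) *
      qPochInf (qPow 1 (2 * r)) (qPow 1 (2 * r)) = Θ r k ε := by
  have product_limit := ((tendsto_prod_one_add_qPow h0 k ε).mul
    (tendsto_prod_one_add_qPow h0 (2 * r - k) ε)).mul_const
      (qPochInf (qPow 1 (2 * r)) (qPow 1 (2 * r)))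
  refine tendsto_nhds_unique product_limit ?_
  refine (tendsto_sum_gaussBinom (constantCoeff_qPow 1 (show 0 < 2 * r by lia))
    (isNullFamily_thetaTerm h0 hk hkr (ε ^ ·))).congr fun N => ?_
  rw [finite_triple_product_qPow hk hkr, mul_comm]

/-- The expansion of `1 / (1 - δ q^d)` in powers of `q`. -/
noncomputable def recipOneSubQPow (δ : ℤˣ) (d : ℤ) : ℤ⟦X⟧ :=
  if 0 < d then Ring.inverse (1 - qPow δ d) else -qPow δ (-d) * Ring.inverse (1 - qPow δ (-d))

theorem recipOneSubQPow_one (d : ℤ) : recipOneSubQPow 1 d = recipOneSub d := by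
  simp [recipOneSubQPow, recipOneSub, qPow]

theorem isUnit_one_sub_qPow (δ : ℤˣ) {d : ℤ} (hd : 0 < d) : IsUnit (1 - qPow δ d) :=
  isUnit_of_constantCoeff_eq_one (by rw [map_sub, constantCoeff_qPow δ hd]; simp)

theorem map_recipOneSubQPow_mul {K : Type*} [Field K] (φ : ℤ⟦X⟧ →+* K) (hX : φ X ≠ 0) (δ : ℤˣ)
    {d : ℤ} (hd : d ≠ 0) : φ (recipOneSubQPow δ d) * (1 - ((δ : ℤ) : K) * φ X ^ d) = 1 := by
  have inverse_mul {e : ℤ} (he : 0 < e) : φ (Ring.inverse (1 - qPow δ e)) *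
      (1 - ((δ : ℤ) : K) * φ X ^ e) = 1 := by
    simpa only [map_mul, map_sub, map_qPow φ _ he.le, map_one] using
      congrArg φ (Ring.inverse_mul_cancel _ (isUnit_one_sub_qPow δ he))
  unfold recipOneSubQPow
  split_ifs with h
  · exact inverse_mul h
  · have hd' : 0 < -d := by lia
    have cancel : φ X ^ (-d) * φ X ^ d = 1 := by rw [← zpow_add₀ hX, neg_add_cancel, zpow_zero]
    rw [map_mul, map_neg, map_qPow φ _ hd'.le]
    linear_combination inverse_mul hd' + φ (Ring.inverse (1 - qPow δ (-d))) *
      (((δ : ℤ) : K) ^ 2 * cancel + units_cast_mul_self (K := K) δ)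

theorem qPow_mul_recipOneSubQPow (δ η : ℤˣ) {a d : ℤ} (hd : d ≠ 0) (ha : 0 ≤ a)
    (had : 0 ≤ a + d) :
    qPow (η * δ) (a + d) * recipOneSubQPow δ d = qPow η a * recipOneSubQPow δ d - qPow η a := by
  have hX := algebraMap_X_ne_zero
  refine IsFractionRing.injective ℤ⟦X⟧ (FractionRing ℤ⟦X⟧) ?_
  set φ := algebraMap ℤ⟦X⟧ (FractionRing ℤ⟦X⟧)
  rw [map_mul, map_sub, map_mul, map_qPow φ _ ha, map_qPow φ _ had, zpow_add₀ hX]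
  push_cast
  linear_combination (-((η : ℤ) : FractionRing ℤ⟦X⟧) * φ X ^ a) * map_recipOneSubQPow_mul φ hX δ hd

theorem two_mul_mul_add_ne_zero {r k : ℤ} (hk : 0 < k) (hkr : k < 2 * r) (n : ℤ) :
    2 * r * n + k ≠ 0 := by
  intro h
  obtain h' | h' : n ≤ -1 ∨ 0 ≤ n := by lia
  all_goals nlinarith

theorem finite_partial_fractions_qPow {r k : ℤ} (hk : 0 < k) (hkr : k < 2 * r) (δ : ℤˣ) (N : ℕ) :
    (∏ i ∈ Finset.range N, (1 + qPow (-δ) k * qPow 1 (2 * r) ^ i)) *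
        (∏ i ∈ Finset.range N, (1 + qPow (-δ) (2 * r - k) * qPow 1 (2 * r) ^ i)) *
        (1 - qPow δ k * qPow 1 (2 * r) ^ N) *
      ∑ n ∈ Finset.Icc (-N : ℤ) N, gaussBinom (qPow 1 (2 * r)) (2 * N) (n + N).toNat *
        (qPow ((-1) ^ n) (r * (n * (n - 1)) + 2 * r * n) * recipOneSubQPow δ (2 * r * n + k)) =
      qPoch (qPow 1 (2 * r)) (2 * N) := by
  have hr : 0 ≤ r := by lia
  have hX := algebraMap_X_ne_zero
  refine IsFractionRing.injective ℤ⟦X⟧ (FractionRing ℤ⟦X⟧) ?_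
  set φ := algebraMap ℤ⟦X⟧ (FractionRing ℤ⟦X⟧)
  set e : FractionRing ℤ⟦X⟧ := ((δ : ℤ) : FractionRing ℤ⟦X⟧) with he
  have recip_mul (n : ℤ) := map_recipOneSubQPow_mul φ hX δ (two_mul_mul_add_ne_zero hk hkr n)
  have denominator_eq (n : ℤ) :
      1 - e * φ X ^ k * (φ X ^ r) ^ (2 * n) = 1 - e * φ X ^ (2 * r * n + k) := by
    rw [← zpow_mul, zpow_add₀ hX]
    ring_nf
  have denominator_ne (n : ℤ) : 1 - e * φ X ^ k * (φ X ^ r) ^ (2 * n) ≠ 0 := by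
    rw [denominator_eq]
    exact right_ne_zero_of_mul_eq_one (recip_mul n)
  have neg_e : (((-δ : ℤˣ) : ℤ) : FractionRing ℤ⟦X⟧) = -e := by simp [he]
  rw [map_mul, map_mul, map_mul, map_prod_one_add φ hr hk.le,
    map_prod_one_add_reflect φ hX hr hkr.le, map_sub, map_mul, map_pow, map_qPow φ _ hk.le, map_one,
    map_qPoch, map_qPow_two_mul φ hr, map_sum, neg_e, neg_mul, ← finite_partial_fractions
      (zpow_ne_zero r hX) (mul_ne_zero (units_cast_ne_zero δ) (zpow_ne_zero k hX)) denominator_ne N,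
    sum_range_two_mul_add_one fun i n => gaussBinom ((φ X ^ r) ^ 2) (2 * N) i *
      ((-1) ^ n * (φ X ^ r) ^ (n * (n + 1)) * (1 - e * φ X ^ k * (φ X ^ r) ^ (2 * n))⁻¹)]
  congr 1
  refine Finset.sum_congr rfl fun n _ => ?_
  rw [map_mul, map_mul, map_gaussBinom, map_qPow_two_mul φ hr,
    map_qPow φ _ (thetaExponent_nonneg (by lia) le_rfl n), units_cast_zpow, denominator_eq,
    eq_inv_of_mul_eq_one_left (recip_mul n), ← zpow_mul,
    show r * (n * (n - 1)) + 2 * r * n = r * (n * (n + 1)) by ring]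
  simp [he]

/-- The finite partial fraction expansions converge to that of the reciprocal of a theta
series. -/
theorem thetaSeries_mul_tsum_recipOneSubQPow {r k : ℤ} (hk : 0 < k) (hkr : k < 2 * r) (δ : ℤˣ) :
    Θ r k (-δ) * ∑' n : ℤ, qPow ((-1) ^ n) (r * (n * (n - 1)) + 2 * r * n) *
      recipOneSubQPow δ (2 * r * n + k) = qPochInf (qPow 1 (2 * r)) (qPow 1 (2 * r)) ^ 3 := by
  have h0 : 0 < r := by lia
  have hq := constantCoeff_qPow 1 (show 0 < 2 * r by lia)
  rw [← qPochInf_mul_eq_thetaSeries h0 hk.le hkr.le]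
  set q := qPow 1 (2 * r)
  have sum_limit := tendsto_sum_gaussBinom hq (((isNullFamily_thetaTerm h0 (show 0 ≤ 2 * r by lia)
    le_rfl ((-1) ^ ·)).of_dvd fun n => dvd_mul_right _ (recipOneSubQPow δ (2 * r * n + k))))
  have last_factor_limit : Tendsto (fun N : ℕ => 1 - qPow δ k * q ^ N) atTop (𝓝 1) := by
    rw [tendsto_iff_X_pow_dvd]
    refine fun d => eventually_atTop.mpr ⟨d, fun N hN => ?_⟩
    rw [sub_sub_cancel_left, dvd_neg]
    exact ((pow_dvd_pow X hN).trans (pow_dvd_pow_of_dvd (X_dvd_iff.mpr hq) N)).mul_left _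
  have lhs_limit := (((tendsto_prod_one_add_qPow h0 k (-δ)).mul
    (tendsto_prod_one_add_qPow h0 (2 * r - k) (-δ))).mul last_factor_limit).mul sum_limit
  have rhs_limit : Tendsto (fun N : ℕ => qPochInf q q * qPoch q (2 * N)) atTop
      (𝓝 (qPochInf q q * qPochInf q q)) :=
    ((tendsto_qPoch hq).comp (tendsto_id.const_mul_atTop' two_pos)).const_mul _
  have limits_eq := tendsto_nhds_unique lhs_limit (rhs_limit.congr fun N => by
    rw [← finite_partial_fractions_qPow hk hkr δ N]
    ring)
  linear_combination qPochInf q q * limits_eq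

/-! ### Appell–Lerch sums -/

theorem eq_qPow_mul_of_quasiperiodic {r k : ℤ} (h0 : 0 ≤ r) (hk : 0 ≤ k) (hkr : k ≤ 2 * r) {ε : ℤˣ}
    {f : ℤ → ℤ⟦X⟧} (hf : ∀ m a b : ℤ, 0 ≤ a → 0 ≤ b → b = a + (2 * r * m + k) →
      qPow 1 a * f (m + 1) = qPow ε b * f m) (m : ℤ) :
    f m = qPow (ε ^ m) (r * (m * (m - 1)) + k * m) * f 0 := by
  have exponent_nonneg := thetaExponent_nonneg (r := r) hk hkr
  induction m with
  | zero => simp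
  | succ m ih =>
    have step_nonneg : 0 ≤ 2 * r * m + k := by positivity
    have step := hf m 0 _ le_rfl step_nonneg (zero_add _).symm
    rw [qPow_one_zero, one_mul] at step
    rw [step, ih, ← mul_assoc, qPow_mul_qPow _ _ step_nonneg (exponent_nonneg m)]
    congr 2
    · rw [zpow_add_one, mul_comm]
    · ring
  | pred m ih =>
    have step_nonneg : 0 ≤ -(2 * r * (-m - 1) + k) := by nlinarith
    have step := hf (-m - 1) _ 0 step_nonneg le_rfl (by ring)
    rw [sub_add_cancel] at step
    have sign_sq : qPow ε 0 * qPow ε 0 = 1 := by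
      rw [qPow_mul_qPow _ _ le_rfl le_rfl, Int.units_mul_self, add_zero, qPow_one_zero]
    calc f (-m - 1) = qPow ε 0 * (qPow ε 0 * f (-m - 1)) := by rw [← mul_assoc, sign_sq, one_mul]
      _ = _ := by
        rw [← step, ih, ← mul_assoc, ← mul_assoc, qPow_mul_qPow _ _ le_rfl step_nonneg,
          qPow_mul_qPow _ _ (by lia) (exponent_nonneg _)]
        congr 2
        · rw [zpow_sub_one, Int.units_inv_eq_self, mul_one, mul_comm]
        · ring

section Appell

variable {r k l : ℤ}

/-- The Appell–Lerch sum `∑ εⁿ q^{r n (n - 1) + l n} / (1 - δ q^{2 r (n + m) + k})`. -/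
noncomputable def appellSum (r k l : ℤ) (δ ε : ℤˣ) (m : ℤ) : ℤ⟦X⟧ :=
  ∑' n : ℤ, qPow (ε ^ n) (r * (n * (n - 1)) + l * n) * recipOneSubQPow δ (2 * r * (n + m) + k)

theorem isNullFamily_appellSum (h0 : 0 < r) (hl : 0 ≤ l) (hlr : l ≤ 2 * r) (δ ε : ℤˣ) (m : ℤ) :
    IsNullFamily fun n : ℤ => qPow (ε ^ n) (r * (n * (n - 1)) + l * n) *
      recipOneSubQPow δ (2 * r * (n + m) + k) :=
  (isNullFamily_thetaTerm h0 hl hlr (ε ^ ·)).of_dvd fun _ => dvd_mul_right ..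

theorem qPow_mul_appellSum_sub_one (hk : 0 < k) (hkr : k < 2 * r) (hl : 0 ≤ l) (hlr : l ≤ 2 * r)
    (δ ε : ℤˣ) {m a b : ℤ} (ha : 0 ≤ a) (hb : 0 ≤ b) (hab : a = b + (2 * r * m + k - l)) :
    qPow (ε * δ) a * appellSum r k l δ ε (m - 1) =
      qPow 1 b * (appellSum r k l δ ε m - Θ r l ε) := by
  have h0 : 0 < r := by lia
  have null_sum (m : ℤ) := isNullFamily_appellSum (k := k) h0 hl hlr δ ε m
  have null_theta := isNullFamily_thetaTerm h0 hl hlr (ε ^ ·)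
  have null_sub : IsNullFamily fun n : ℤ => qPow (ε ^ n) (r * (n * (n - 1)) + l * n) *
      recipOneSubQPow δ (2 * r * (n + m) + k) - qPow (ε ^ n) (r * (n * (n - 1)) + l * n) :=
    null_theta.of_dvd fun _ => dvd_sub (dvd_mul_right ..) dvd_rfl
  unfold appellSum thetaSeries
  rw [← (null_sum m).summable.tsum_sub null_theta.summable, null_sub.mul_tsum,
    (null_sum (m - 1)).mul_tsum, ← (Equiv.addRight (1 : ℤ)).tsum_eq]
  refine tsum_congr fun n => ?_
  have exp_nonneg := thetaExponent_nonneg hl hlr n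
  have exp_succ_nonneg := thetaExponent_nonneg hl hlr (n + 1)
  have exp_eq : a + (r * ((n + 1) * (n + 1 - 1)) + l * (n + 1)) =
      b + (r * (n * (n - 1)) + l * n) + (2 * r * (n + m) + k) := by
    rw [hab]
    ring
  have recip := qPow_mul_recipOneSubQPow δ (ε ^ n) (two_mul_mul_add_ne_zero hk hkr (n + m))
    (add_nonneg hb exp_nonneg) (exp_eq ▸ add_nonneg ha exp_succ_nonneg)
  have sign : ε * δ * ε ^ (n + 1) = ε ^ n * δ := by
    rw [zpow_add_one, mul_comm (ε ^ n), mul_mul_mul_comm, Int.units_mul_self, one_mul, mul_comm]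
  rw [Equiv.coe_addRight, ← mul_assoc, qPow_mul_qPow _ _ ha exp_succ_nonneg, sign, exp_eq,
    show n + 1 + (m - 1) = n + m by ring, recip, mul_sub (qPow 1 b), ← mul_assoc (qPow 1 b),
    qPow_mul_qPow _ _ hb exp_nonneg, one_mul]

theorem appellSum_alternating (hk : 0 < k) (hkr : k < 2 * r) (δ : ℤˣ) (m : ℤ) :
    appellSum r k (2 * r) δ (-1) m =
      qPow ((-δ) ^ m) (r * (m * (m - 1)) + k * m) * appellSum r k (2 * r) δ (-1) 0 := by
  have theta_eq_zero : Θ r (2 * r) (-1) = 0 := by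
    rw [← thetaSeries_zero_neg_one r, ← thetaSeries_reflect r 0, sub_zero]
  refine eq_qPow_mul_of_quasiperiodic (by lia) hk.le hkr.le (fun m a b ha hb hab => ?_) m
  have step := qPow_mul_appellSum_sub_one hk hkr (by lia) le_rfl δ (-1) hb ha (m := m + 1)
    (by rw [hab]; ring)
  rw [neg_one_mul, add_sub_cancel_right, theta_eq_zero, sub_zero] at step
  exact step.symm

/-- The combination of Appell–Lerch sums in which the inhomogeneous terms of
`qPow_mul_appellSum_sub_one` cancel. -/
noncomputable def appellDiff (r k m : ℤ) : ℤ⟦X⟧ :=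
  Θ r k 1 * appellSum r k k 1 (-1) m - Θ r k (-1) * appellSum r k k (-1) 1 m

theorem appellDiff_sub_one (hk : 0 < k) (hkr : k < 2 * r) (m : ℤ) :
    appellDiff r k (m - 1) =
      qPow ((-1) ^ m) (r * (m * (m - 1)) + 0 * m) * appellDiff r k (-1) := by
  refine eq_qPow_mul_of_quasiperiodic (f := fun m => appellDiff r k (m - 1)) (by lia) le_rfl
    (by lia) (fun m a b ha hb hab => ?_) m
  have step_pos := qPow_mul_appellSum_sub_one hk hkr hk.le hkr.le 1 (-1) hb ha (m := m)
    (by rw [hab]; ring)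
  have step_neg := qPow_mul_appellSum_sub_one hk hkr hk.le hkr.le (-1) 1 hb ha (m := m)
    (by rw [hab]; ring)
  rw [mul_one] at step_pos
  rw [one_mul] at step_neg
  simp only [appellDiff, add_sub_cancel_right]
  linear_combination Θ r k (-1) * step_neg - Θ r k 1 * step_pos

theorem qPow_one_zpow_eq_sq (hk : 0 ≤ k) (hkr : k ≤ 2 * r) (ε : ℤˣ) (n : ℤ) :
    qPow (1 ^ n) (2 * r * (n * (n - 1)) + 2 * k * n) =
      qPow (ε ^ n) (r * (n * (n - 1)) + k * n) ^ 2 := by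
  have exp_nonneg := thetaExponent_nonneg hk hkr n
  rw [sq, qPow_mul_qPow _ _ exp_nonneg exp_nonneg, Int.units_mul_self, one_zpow]
  congr 1
  ring

theorem tsum_qPow_mul_appellSum (hk : 0 < k) (hkr : k < 2 * r) (δ : ℤˣ) :
    ∑' n : ℤ, qPow ((-1) ^ n) (r * (n * (n - 1)) + 0 * n) * appellSum r k k δ (-δ) (n - 1) =
      -(Θ (2 * r) (2 * k) 1 * appellSum r k (2 * r) δ (-1) 0) := by
  have h0 : 0 < r := by lia
  have null_sign := isNullFamily_thetaTerm h0 le_rfl (show 0 ≤ 2 * r by lia) ((-1) ^ ·)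
  have null_theta := isNullFamily_thetaTerm h0 hk.le hkr.le ((-δ) ^ ·)
  have null_double := isNullFamily_thetaTerm (r := 2 * r) (k := 2 * k) (by lia) (by lia) (by lia)
    (1 ^ ·)
  have null_joint : IsNullFamily fun x : ℤ × ℤ =>
      qPow ((-1) ^ x.1) (r * (x.1 * (x.1 - 1)) + 0 * x.1) *
        (qPow ((-δ) ^ x.2) (r * (x.2 * (x.2 - 1)) + k * x.2) *
          recipOneSubQPow δ (2 * r * (x.2 + (x.1 - 1)) + k)) :=
    (null_sign.prod null_theta).of_dvd fun _ => mul_dvd_mul_left _ (dvd_mul_right ..)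
  have inner_sum (p : ℤ) : ∑' n : ℤ, qPow ((-1) ^ n) (r * (n * (n - 1)) + 0 * n) *
      (qPow ((-δ) ^ p) (r * (p * (p - 1)) + k * p) *
        recipOneSubQPow δ (2 * r * (p + (n - 1)) + k)) =
      -(qPow (1 ^ p) (2 * r * (p * (p - 1)) + 2 * k * p) *
        appellSum r k (2 * r) δ (-1) 0) := by
    rw [qPow_one_zpow_eq_sq hk.le hkr.le (-δ), sq, mul_assoc, ← appellSum_alternating hk hkr,
      appellSum, (isNullFamily_appellSum h0 (by lia) le_rfl δ (-1) p).mul_tsum, ← tsum_neg,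
      ← (Equiv.addRight (1 : ℤ)).tsum_eq]
    refine tsum_congr fun n => ?_
    rw [Equiv.coe_addRight, zpow_add_one, mul_neg_one, qPow_neg, add_sub_cancel_right, add_comm p,
      show r * ((n + 1) * n) + 0 * (n + 1) = r * (n * (n - 1)) + 2 * r * n by ring]
    ring
  unfold appellSum at inner_sum ⊢
  simp only [(isNullFamily_appellSum h0 hk.le hkr.le δ (-δ) _).mul_tsum]
  rw [null_joint.tsum_comm, tsum_congr inner_sum, tsum_neg, thetaSeries,
    null_double.summable.tsum_mul_right]

theorem constantCoeff_thetaSeries (hk : 0 < k) (hkr : k < 2 * r) (ε : ℤˣ) :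
    constantCoeff (Θ r k ε) = 1 := by
  have hq := constantCoeff_qPow 1 (show 0 < 2 * r by lia)
  have neg_const {a : ℤ} (ha : 0 < a) : constantCoeff (-qPow ε a) = 0 := by
    rw [map_neg, constantCoeff_qPow ε ha, neg_zero]
  rw [← qPochInf_mul_eq_thetaSeries (by lia) hk.le hkr.le, map_mul, map_mul,
    constantCoeff_qPochInf (neg_const hk) hq, constantCoeff_qPochInf (neg_const (by lia)) hq,
    constantCoeff_qPochInf hq hq, mul_one, mul_one]

theorem thetaSeries_ne_zero (hk : 0 < k) (hkr : k < 2 * r) (ε : ℤˣ) : Θ r k ε ≠ 0 := fun h => by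
  simpa [h] using constantCoeff_thetaSeries hk hkr ε

theorem two_ne_zero_powerSeries : (2 : ℤ⟦X⟧) ≠ 0 := fun h =>
  two_ne_zero (α := ℤ) (by simpa only [map_ofNat, map_zero] using congrArg constantCoeff h)

theorem thetaSeries_zero_one_ne_zero (h0 : 0 < r) : Θ r 0 1 ≠ 0 := by
  rw [thetaSeries_zero_one h0]
  exact mul_ne_zero two_ne_zero_powerSeries (thetaSeries_ne_zero (by lia) (by lia) 1)

theorem thetaSeries_mul_appellDiff (hk : 0 < k) (hkr : k < 2 * r) :
    Θ (2 * r) 0 1 * appellDiff r k (-1) =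
      -(Θ (2 * r) (2 * k) 1 * (Θ r k 1 * appellSum r k (2 * r) 1 (-1) 0 -
        Θ r k (-1) * appellSum r k (2 * r) (-1) (-1) 0)) := by
  have h0 : 0 < r := by lia
  have null_sign := isNullFamily_thetaTerm h0 le_rfl (show 0 ≤ 2 * r by lia) ((-1) ^ ·)
  have null (δ : ℤˣ) : IsNullFamily fun n : ℤ => qPow ((-1) ^ n) (r * (n * (n - 1)) + 0 * n) *
      appellSum r k k δ (-δ) (n - 1) := null_sign.of_dvd fun _ => dvd_mul_right ..
  have sum_one := tsum_qPow_mul_appellSum hk hkr 1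
  have sum_neg_one := tsum_qPow_mul_appellSum hk hkr (-1)
  calc Θ (2 * r) 0 1 * appellDiff r k (-1)
      = ∑' n : ℤ, qPow ((-1) ^ n) (r * (n * (n - 1)) + 0 * n) * appellDiff r k (n - 1) := by
        rw [thetaSeries, ← (isNullFamily_thetaTerm (r := 2 * r) (by lia) le_rfl (by lia)
          (1 ^ ·)).summable.tsum_mul_right]
        refine tsum_congr fun n => ?_
        have qPow_sq := qPow_one_zpow_eq_sq (r := r) le_rfl (by lia) (-1) n
        rw [mul_zero] at qPow_sq
        rw [appellDiff_sub_one hk hkr, qPow_sq, pow_two, mul_assoc]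
    _ = Θ r k 1 * ∑' n : ℤ, qPow ((-1) ^ n) (r * (n * (n - 1)) + 0 * n) *
          appellSum r k k 1 (-1) (n - 1) -
        Θ r k (-1) * ∑' n : ℤ, qPow ((-1) ^ n) (r * (n * (n - 1)) + 0 * n) *
          appellSum r k k (-1) (- -1) (n - 1) := by
        rw [(null 1).mul_tsum, (null (-1)).mul_tsum,
          ← ((null 1).mul_left _).summable.tsum_sub ((null (-1)).mul_left _).summable]
        refine tsum_congr fun n => ?_
        rw [appellDiff, neg_neg]
        ring
    _ = _ := by
        rw [sum_one, sum_neg_one]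
        ring

theorem thetaSeries_mul_appellSum_alternating (hk : 0 < k) (hkr : k < 2 * r) (δ : ℤˣ) :
    Θ r k (-δ) * appellSum r k (2 * r) δ (-1) 0 =
      qPochInf (qPow 1 (2 * r)) (qPow 1 (2 * r)) ^ 3 := by
  simpa only [appellSum, add_zero] using thetaSeries_mul_tsum_recipOneSubQPow hk hkr δ

theorem thetaSeries_one_sq_sub_neg_one_sq (hk : 0 ≤ k) (hkr : k ≤ r) (h0 : 0 < r) :
    Θ r k 1 ^ 2 - Θ r k (-1) ^ 2 =
      2 * qPow 1 k * Θ (2 * r) (2 * k + 2 * r) 1 * Θ (2 * r) 0 1 := by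
  have sq_one := thetaSeries_mul_thetaSeries h0 hk le_rfl (by lia) 1 1
  have sq_neg_one := thetaSeries_mul_thetaSeries h0 hk le_rfl (by lia) (-1) (-1)
  rw [mul_one, sub_self, ← two_mul k] at sq_one
  rw [qPow_neg, Int.units_mul_self, sub_self, ← two_mul k] at sq_neg_one
  linear_combination sq_one - sq_neg_one

theorem thetaSeries_mul_mul_appellDiff (hk : 0 < k) (hkr : k ≤ r) :
    Θ r k 1 * Θ r k (-1) * appellDiff r k (-1) =
      -(2 * qPow 1 k * qPochInf (qPow 1 (2 * r)) (qPow 1 (2 * r)) ^ 3 *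
        (Θ (2 * r) (2 * k) 1 * Θ (2 * r) (2 * k + 2 * r) 1)) := by
  have h0 : 0 < r := by lia
  have hkr' : k < 2 * r := by lia
  have sum_one := thetaSeries_mul_appellSum_alternating hk hkr' 1
  have sum_neg_one := thetaSeries_mul_appellSum_alternating hk hkr' (-1)
  rw [neg_neg] at sum_neg_one
  refine mul_left_cancel₀ (thetaSeries_zero_one_ne_zero (show 0 < 2 * r by lia)) ?_
  linear_combination Θ r k 1 * Θ r k (-1) * thetaSeries_mul_appellDiff hk hkr' -
    Θ (2 * r) (2 * k) 1 * Θ r k 1 ^ 2 * sum_one +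
    Θ (2 * r) (2 * k) 1 * Θ r k (-1) ^ 2 * sum_neg_one -
    Θ (2 * r) (2 * k) 1 * qPochInf (qPow 1 (2 * r)) (qPow 1 (2 * r)) ^ 3 *
      thetaSeries_one_sq_sub_neg_one_sq hk.le hkr h0

end Appell

/-! ### Substitutions -/

section Substitution

variable {φ : ℤ⟦X⟧ →+* ℤ⟦X⟧}

theorem continuous_of_X_dvd (hφ : X ∣ φ X) : Continuous φ := by
  refine continuous_iff_continuousAt.mpr fun f => tendsto_iff_X_pow_dvd.mpr fun d => ?_
  filter_upwards [tendsto_iff_X_pow_dvd.mp (tendsto_id (α := ℤ⟦X⟧) (x := 𝓝 f)) d] with u hu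
  rw [← map_sub]
  refine (pow_dvd_pow_of_dvd hφ d).trans ?_
  rw [← map_pow]
  exact map_dvd φ hu

theorem map_qPochInf (hφ : X ∣ φ X) (a : ℤ⟦X⟧) {u : ℤ⟦X⟧} (hu : constantCoeff u = 0) :
    φ (qPochInf a u) = qPochInf (φ a) (φ u) := by
  unfold qPochInf
  rw [(multipliable_qPochInf a hu).map_tprod φ (continuous_of_X_dvd hφ)]
  exact tprod_congr fun k => by rw [map_sub, map_one, map_mul, map_pow]

theorem map_ringInverse {R S : Type*} [Ring R] [Ring S] (φ : R →+* S) {u : R} (hu : IsUnit u) :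
    φ (Ring.inverse u) = Ring.inverse (φ u) := by
  obtain ⟨u, rfl⟩ := hu
  rw [Ring.inverse_unit]
  exact (Ring.inverse_unit (Units.map (φ : R →* S) u)).symm

theorem units_zpow_thetaExponent (η : ℤˣ) (r k n : ℤ) :
    η ^ (r * (n * (n - 1)) + k * n) = (η ^ k) ^ n := by
  obtain ⟨c, hc⟩ := Int.even_mul_pred_self n
  rw [zpow_add, hc, zpow_mul η k n, ← two_mul, mul_left_comm, units_zpow_two_mul, one_mul]

variable {m : ℤ} {η : ℤˣ}

theorem map_qPow_of_map_X (hm : 0 ≤ m) (hφ : φ X = qPow η m) (ε : ℤˣ) {a : ℤ} (ha : 0 ≤ a) :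
    φ (qPow ε a) = qPow (ε * η ^ a) (m * a) := by
  obtain ⟨n, rfl⟩ := Int.eq_ofNat_of_zero_le ha
  rw [qPow_natCast, map_mul, map_intCast, map_pow, hφ, qPow, qPow, mul_pow, ← pow_mul,
    Int.toNat_mul hm ha, Int.toNat_natCast, zpow_natCast]
  push_cast
  ring

theorem X_dvd_map_X (hm : 0 < m) (hφ : φ X = qPow η m) : X ∣ φ X := by
  rw [hφ, ← pow_one X]
  exact X_pow_dvd_qPow η (by lia)

theorem map_thetaSeries (hm : 0 < m) (hφ : φ X = qPow η m) {r k : ℤ} (h0 : 0 < r) (hk : 0 ≤ k)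
    (hkr : k ≤ 2 * r) (ε : ℤˣ) : φ (Θ r k ε) = Θ (m * r) (m * k) (ε * η ^ k) := by
  unfold thetaSeries
  rw [(isNullFamily_thetaTerm h0 hk hkr (ε ^ ·)).summable.map_tsum φ
    (continuous_of_X_dvd (X_dvd_map_X hm hφ))]
  refine tsum_congr fun n => ?_
  rw [map_qPow_of_map_X hm.le hφ _ (thetaExponent_nonneg hk hkr n), units_zpow_thetaExponent,
    ← mul_zpow]
  congr 1
  ring

theorem map_recipOneSubQPow (hm : 0 < m) (hφ : φ X = qPow η m) {d : ℤ} (hd : d ≠ 0) (δ : ℤˣ) :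
    φ (recipOneSubQPow δ d) = recipOneSubQPow (δ * η ^ d) (m * d) := by
  unfold recipOneSubQPow
  rcases hd.lt_or_gt with neg | pos
  · have d_nonpos : ¬ 0 < d := neg.not_gt
    have md_nonpos : ¬ 0 < m * d := (mul_neg_of_pos_of_neg hm neg).not_gt
    rw [if_neg d_nonpos, if_neg md_nonpos, map_mul, map_neg,
      map_ringInverse φ (isUnit_one_sub_qPow δ (by lia)), map_sub, map_one,
      map_qPow_of_map_X hm.le hφ _ (by lia), zpow_neg, Int.units_inv_eq_self, mul_neg]
  · rw [if_pos pos, if_pos (mul_pos hm pos), map_ringInverse φ (isUnit_one_sub_qPow δ pos), map_sub,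
      map_one, map_qPow_of_map_X hm.le hφ _ pos.le]

theorem map_appellSum (hm : 0 < m) (hφ : φ X = qPow η m) {r k l : ℤ} (hk : 0 < k)
    (hkr : k < 2 * r) (hl : 0 ≤ l) (hlr : l ≤ 2 * r) (δ ε : ℤˣ) (j : ℤ) :
    φ (appellSum r k l δ ε j) = appellSum (m * r) (m * k) (m * l) (δ * η ^ k) (ε * η ^ l) j := by
  unfold appellSum
  rw [(isNullFamily_appellSum (by lia) hl hlr δ ε j).summable.map_tsum φ
    (continuous_of_X_dvd (X_dvd_map_X hm hφ))]
  refine tsum_congr fun n => ?_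
  rw [map_mul, map_qPow_of_map_X hm.le hφ _ (thetaExponent_nonneg hl hlr n),
    units_zpow_thetaExponent, ← mul_zpow,
    map_recipOneSubQPow hm hφ (two_mul_mul_add_ne_zero hk hkr (n + j)), zpow_add, mul_assoc 2 r,
    units_zpow_two_mul, one_mul]
  congr 2 <;> ring

theorem evalNegHom_X_eq_qPow : evalNegHom (X : ℤ⟦X⟧) = qPow (-1) 1 := by
  rw [evalNegHom_X, qPow_neg, qPow_one_one]

theorem expand_X_eq_qPow {m : ℕ} (hm : m ≠ 0) :
    expand m hm (X : ℤ⟦X⟧) = qPow 1 m := by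
  rw [expand_X, qPow_one_natCast]

theorem expand_thetaSeries {m : ℕ} (hm : m ≠ 0) {r k : ℤ} (h0 : 0 < r) (hk : 0 ≤ k)
    (hkr : k ≤ 2 * r) (ε : ℤˣ) : expand m hm (Θ r k ε) = Θ (m * r) (m * k) ε :=
  (map_thetaSeries (φ := (expand m hm : ℤ⟦X⟧ →ₐ[ℤ] ℤ⟦X⟧)) (by lia) (expand_X_eq_qPow hm) h0 hk hkr
    ε).trans (by rw [one_zpow, mul_one])

theorem expand_E {m : ℕ} (hm : m ≠ 0) {j : ℕ} (hj : j ≠ 0) : expand m hm (E j) = E (m * j) := by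
  have map_E := map_qPochInf (φ := (expand m hm : ℤ⟦X⟧ →ₐ[ℤ] ℤ⟦X⟧))
    (expand_X (R := ℤ) m hm ▸ dvd_pow_self X hm) (X ^ j) (u := X ^ j) (by simp [hj])
  rw [E, E, pow_mul, ← expand_X m hm, ← map_pow]
  exact map_E

theorem expand_injective {R : Type*} [CommRing R] {m : ℕ} (hm : m ≠ 0) :
    Function.Injective (expand m hm : R⟦X⟧ →ₐ[R] R⟦X⟧) := by
  intro f g h
  ext n
  rw [← coeff_expand_mul m hm f, h, coeff_expand_mul]

end Substitution

/-! ### The odd part of an Appell–Lerch series -/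

section OddPart

theorem neg_one_pow_natAbs {R : Type*} [Ring R] (n : ℤ) :
    (-1 : R) ^ n.natAbs = (((-1 : ℤˣ) ^ n : ℤˣ) : ℤ) := by
  rcases Int.even_or_odd n with h | h
  · simp [h.neg_one_zpow, (Int.natAbs_even.mpr h).neg_one_pow]
  · simp [h.neg_one_zpow, (Int.natAbs_odd.mpr h).neg_one_pow]

theorem tsum_appellTerm (r j : ℕ) :
    ∑' n : ℤ, appellTerm j (2 * r) n = -appellSum r j j 1 (-1) (-1) := by
  unfold appellSum
  rw [← tsum_neg, ← (Equiv.addRight (1 : ℤ)).tsum_eq fun n : ℤ => -(qPow ((-1) ^ n) _ * _)]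
  refine tsum_congr fun n => ?_
  have exponent_eq : ((2 * r : ℕ) : ℤ) * (n * (n + 1) / 2) + j * n + j =
      r * ((n + 1) * (n + 1 - 1)) + j * (n + 1) := by
    push_cast
    linear_combination (r : ℤ) * two_mul_tri n
  rw [Equiv.coe_addRight, recipOneSubQPow_one, zpow_add_one, mul_neg_one, qPow_neg, neg_mul,
    neg_neg, appellTerm, qPow, neg_one_pow_natAbs, exponent_eq, add_neg_cancel_right]
  push_cast
  rfl

variable {r j : ℕ}

theorem thetaSeries_mul_appellSeries (hj : 0 < j) (hjr : j < 2 * r) :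
    Θ r j (-1) * appellSeries j (2 * r) = -appellSum r j j 1 (-1) (-1) := by
  have product_eq : qPochInf (X ^ j) (X ^ (2 * r)) * qPochInf (X ^ (2 * r - j)) (X ^ (2 * r)) *
      qPochInf (X ^ (2 * r)) (X ^ (2 * r)) = Θ r j (-1) := by
    rw [← qPochInf_mul_eq_thetaSeries (by lia) (by lia) (by lia)]
    simp only [qPow_neg, neg_neg, ← qPow_one_natCast]
    push_cast [hjr.le]
    rfl
  rw [appellSeries, product_eq, tsum_appellTerm, Ring.mul_inverse_cancel_left]
  exact isUnit_of_constantCoeff_eq_one (constantCoeff_thetaSeries (by lia) (by lia) _)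

theorem thetaSeries_mul_evalNegHom_appellSeries (hj : Odd j) (hjr : j < 2 * r) :
    Θ r j 1 * evalNegHom (appellSeries j (2 * r)) = -appellSum r j j (-1) 1 (-1) := by
  have hj0 : 0 < j := hj.pos
  have image := congrArg evalNegHom (thetaSeries_mul_appellSeries hj0 hjr)
  rw [map_mul, map_neg,
    map_thetaSeries one_pos evalNegHom_X_eq_qPow (by lia) (by lia) (by lia),
    map_appellSum one_pos evalNegHom_X_eq_qPow (by lia) (by lia) (by lia) (by lia)] at image
  simpa only [zpow_natCast, hj.neg_one_pow, mul_neg_one, neg_neg, one_mul] using image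

theorem sub_evalNegHom {R : Type*} [CommRing R] (f : R⟦X⟧) : f - evalNegHom f =
    2 * (X * expand 2 two_ne_zero (PowerSeries.mk fun n => coeff (2 * n + 1) f)) := by
  ext n
  rw [map_sub, evalNegHom, coeff_rescale, ← map_ofNat (C (R := R)), coeff_C_mul]
  rcases n with _ | n
  · simp
  rw [coeff_succ_X_mul]
  rcases Nat.even_or_odd' n with ⟨c, rfl | rfl⟩
  · rw [coeff_expand_mul, coeff_mk, (odd_two_mul_add_one c).neg_one_pow]
    ring
  · rw [coeff_expand_of_not_dvd _ _ _ (by lia), Even.neg_one_pow ⟨c + 1, by ring⟩]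
    ring

theorem thetaSeries_one_mul_neg_one {r k : ℤ} (h0 : 0 < r) (hk : 0 ≤ k) (hkr : k ≤ r) :
    Θ r k 1 * Θ r k (-1) = Θ (2 * r) (2 * k) (-1) * Θ (2 * r) (2 * r) (-1) := by
  rw [thetaSeries_mul_thetaSeries h0 hk le_rfl (by lia) 1 (-1), sub_self, zero_add, one_mul,
    thetaSeries_zero_neg_one, mul_zero, add_zero, two_mul k]

/-- The odd part of `A(q) = appellSeries j (2 * r)` is `(A(q) - A(-q)) / 2`, and for odd `j` the
difference `A(q) - A(-q)` is a multiple of `appellDiff r j (-1)`. -/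
theorem odd_part_appellSeries {c : ℕ} (hc : 2 * c + 1 ≤ r) :
    PowerSeries.mk (fun n : ℕ => a (2 * c + 1) (2 * r) (2 * n + 1)) *
        (Θ r (2 * c + 1) (-1) * Θ r r (-1)) ^ 2 =
      X ^ c * E r ^ 3 * (Θ r (2 * c + 1) 1 * Θ r (2 * c + 1 + r) 1) := by
  have at_q := thetaSeries_mul_appellSeries (r := r) (j := 2 * c + 1) (by lia) (by lia)
  have at_neg_q := thetaSeries_mul_evalNegHom_appellSeries (r := r) (odd_two_mul_add_one c)
    (by lia)
  have diff := thetaSeries_mul_mul_appellDiff (r := r) (k := (2 * c + 1 : ℕ)) (by lia) (by lia)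
  have theta_prod := thetaSeries_one_mul_neg_one (r := r) (k := (2 * c + 1 : ℕ)) (by lia) (by lia)
    (by lia)
  have odd_part := sub_evalNegHom (appellSeries (2 * c + 1) (2 * r))
  have E_eq : qPochInf (qPow 1 (2 * r)) (qPow 1 (2 * r)) = E (2 * r) := by
    rw [E, ← qPow_one_natCast]
    push_cast
    rfl
  rw [appellDiff, qPow_one_natCast, E_eq] at diff
  refine expand_injective two_ne_zero ?_
  simp only [map_mul, map_pow, expand_X, expand_E two_ne_zero (show r ≠ 0 by lia)]
  rw [expand_thetaSeries _ (by lia) (by lia) (by lia), expand_thetaSeries _ (by lia) (by lia)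
    (by lia), expand_thetaSeries _ (by lia) (by lia) (by lia), expand_thetaSeries _ (by lia)
    (by lia) (by lia)]
  refine mul_left_cancel₀ (mul_ne_zero two_ne_zero_powerSeries X_ne_zero) ?_
  push_cast [a] at at_q at_neg_q diff theta_prod ⊢
  rw [← theta_prod, mul_add (2 : ℤ) _ (r : ℤ)]
  linear_combination
    (-(Θ r (2 * c + 1) 1 * Θ r (2 * c + 1) (-1)) ^ 2) * odd_part - diff +
    Θ r (2 * c + 1) 1 ^ 2 * Θ r (2 * c + 1) (-1) * at_q -
    Θ r (2 * c + 1) 1 * Θ r (2 * c + 1) (-1) ^ 2 * at_neg_q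

end OddPart

/-! ### Infinite products -/

theorem qPochInf_split (a : ℤ⟦X⟧) {u : ℤ⟦X⟧} (hu : constantCoeff u = 0) {m : ℕ} (hm : m ≠ 0) :
    qPochInf a u = ∏ j ∈ Finset.range m, qPochInf (a * u ^ j) (u ^ m) := by
  have along_multiples := (tendsto_prod_qPochInf a hu).comp
    (tendsto_id.const_mul_atTop' (Nat.pos_of_ne_zero hm))
  have by_residue : Tendsto (fun N => ∏ j ∈ Finset.range m, ∏ i ∈ Finset.range N,
      (1 - a * u ^ j * (u ^ m) ^ i)) atTop
      (𝓝 (∏ j ∈ Finset.range m, qPochInf (a * u ^ j) (u ^ m))) :=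
    tendsto_finsetProd _ fun j _ => tendsto_prod_qPochInf _ (by simp [hu, hm])
  refine tendsto_nhds_unique along_multiples (by_residue.congr fun N => ?_)
  simp only [Function.comp_apply, id_eq]
  induction N with
  | zero => simp
  | succ N ih =>
    rw [mul_add_one, Finset.prod_range_add, ← ih, ← Finset.prod_mul_distrib]
    refine Finset.prod_congr rfl fun j _ => ?_
    rw [Finset.prod_range_succ]
    ring

theorem qPochInf_neg_mul (a : ℤ⟦X⟧) {u : ℤ⟦X⟧} (hu : constantCoeff u = 0) :
    qPochInf (-a) u * qPochInf a u = qPochInf (a ^ 2) (u ^ 2) := by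
  unfold qPochInf
  rw [← (multipliable_qPochInf (-a) hu).tprod_mul (multipliable_qPochInf a hu)]
  exact tprod_congr fun k => by ring

/-- The infinite product `(ε q^i; q^n)_∞`. -/
noncomputable def qPochPow (ε : ℤˣ) (i n : ℤ) : ℤ⟦X⟧ := qPochInf (qPow ε i) (qPow 1 n)

theorem E_eq_qPochPow (j : ℕ) : E j = qPochPow 1 j j := by
  rw [E, qPochPow, qPow_one_natCast]

theorem qPow_pow (ε : ℤˣ) {a : ℤ} (ha : 0 ≤ a) (j : ℕ) : qPow ε a ^ j = qPow (ε ^ j) (a * j) := by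
  rw [qPow, qPow, mul_pow, ← pow_mul, Int.toNat_mul ha (by lia), Int.toNat_natCast]
  push_cast
  rfl

theorem qPochPow_split (ε : ℤˣ) {i n : ℤ} (hi : 0 ≤ i) (hn : 0 < n) {m : ℕ} (hm : m ≠ 0) :
    qPochPow ε i n = ∏ j ∈ Finset.range m, qPochPow ε (i + n * j) (n * m) := by
  unfold qPochPow
  rw [qPochInf_split _ (constantCoeff_qPow 1 hn) hm]
  refine Finset.prod_congr rfl fun j _ => ?_
  rw [qPow_pow 1 hn.le, qPow_pow 1 hn.le, qPow_mul_qPow ε _ hi (by positivity), one_pow, one_pow,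
    mul_one]

theorem qPochPow_neg_one_mul (i : ℤ) (hi : 0 ≤ i) {n : ℤ} (hn : 0 < n) :
    qPochPow (-1) i n * qPochPow 1 i n = qPochPow 1 (2 * i) (2 * n) := by
  unfold qPochPow
  rw [qPow_neg, qPochInf_neg_mul _ (constantCoeff_qPow 1 hn), qPow_pow 1 hi, qPow_pow 1 hn.le,
    one_pow, Nat.cast_ofNat, mul_comm i, mul_comm n]

theorem thetaSeries_eq_qPochPow {r k : ℤ} (h0 : 0 < r) (hk : 0 ≤ k) (hkr : k ≤ 2 * r) (ε : ℤˣ) :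
    Θ r k ε = qPochPow (-ε) k (2 * r) * qPochPow (-ε) (2 * r - k) (2 * r) *
      qPochPow 1 (2 * r) (2 * r) := by
  rw [← qPochInf_mul_eq_thetaSeries h0 hk hkr, ← qPow_neg, ← qPow_neg]
  rfl

section EtaQuotients

variable {r : ℕ}

theorem E_eq_qPochPow_mul_E (hr : r ≠ 0) : E r = qPochPow 1 r (2 * r) * E (2 * r) := by
  have split := qPochPow_split 1 (i := r) (n := r) (by lia) (by lia) two_ne_zero
  rw [Finset.prod_range_succ, Finset.prod_range_one] at split
  rw [E_eq_qPochPow, split, E_eq_qPochPow]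
  push_cast
  ring_nf

theorem thetaSeries_self_eq (hr : r ≠ 0) (ε : ℤˣ) :
    Θ r r ε = qPochPow (-ε) r (2 * r) ^ 2 * E (2 * r) := by
  rw [thetaSeries_eq_qPochPow (by lia) (by lia) (by lia), E_eq_qPochPow]
  push_cast
  ring_nf

theorem thetaSeries_self_neg_one_mul_E (hr : r ≠ 0) : Θ r r (-1) * E (2 * r) = E r ^ 2 := by
  rw [thetaSeries_self_eq hr, E_eq_qPochPow_mul_E hr, neg_neg]
  ring

theorem E_two_mul_eq (hr : r ≠ 0) :
    E (2 * r) = qPochPow (-1) r (2 * r) * qPochPow 1 r (2 * r) * E (4 * r) := by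
  rw [qPochPow_neg_one_mul _ (by lia) (by lia), E_eq_qPochPow_mul_E (r := 2 * r) (by lia)]
  push_cast
  ring_nf

theorem thetaSeries_self_one_mul_E (hr : r ≠ 0) :
    Θ r r 1 * E r ^ 2 * E (4 * r) ^ 2 = E (2 * r) ^ 5 := by
  rw [thetaSeries_self_eq hr, E_eq_qPochPow_mul_E hr]
  linear_combination (E (2 * r) ^ 4 + E (2 * r) ^ 3 * qPochPow (-1) r (2 * r) *
    qPochPow 1 r (2 * r) * E (4 * r)) * -E_two_mul_eq hr

theorem thetaSeries_two_mul_self_one_mul_E (hr : r ≠ 0) :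
    Θ (2 * r) r 1 * E r = E (2 * r) ^ 2 := by
  have split := qPochPow_split (-1) (i := r) (n := 2 * r) (by lia) (by lia) two_ne_zero
  rw [Finset.prod_range_succ, Finset.prod_range_one] at split
  have theta_eq : Θ (2 * r) r 1 = qPochPow (-1) r (2 * r) * E (4 * r) := by
    rw [thetaSeries_eq_qPochPow (by lia) (by lia) (by lia), split, E_eq_qPochPow]
    push_cast
    ring_nf
  rw [theta_eq, E_eq_qPochPow_mul_E hr]
  linear_combination -E (2 * r) * E_two_mul_eq hr

end EtaQuotients

theorem E_two_eq : E 2 = qPochPow 1 2 10 * qPochPow 1 4 10 * qPochPow 1 6 10 * qPochPow 1 8 10 *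
    E 10 := by
  simpa [E_eq_qPochPow, Finset.prod_range_succ] using
    qPochPow_split 1 (i := 2) (n := 2) (m := 5) (by norm_num) (by norm_num) (by norm_num)

theorem qPochPow_one_two_eq : qPochPow 1 1 2 = qPochPow 1 1 10 * qPochPow 1 3 10 *
    qPochPow 1 5 10 * qPochPow 1 7 10 * qPochPow 1 9 10 := by
  simpa [Finset.prod_range_succ] using
    qPochPow_split 1 (i := 1) (n := 2) (m := 5) (by norm_num) (by norm_num) (by norm_num)

theorem thetaSeries_five_one_mul_five_three_mul_E :
    Θ 5 1 (-1) * Θ 5 3 (-1) * E 2 * E 5 = E 1 * E 10 ^ 3 := by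
  have E_one := E_eq_qPochPow_mul_E one_ne_zero
  have E_five := E_eq_qPochPow_mul_E (r := 5) (by norm_num)
  have theta {k : ℤ} (hk : 0 ≤ k) (hk5 : k ≤ 10) := thetaSeries_eq_qPochPow (r := 5)
    (by norm_num) hk hk5 (-1)
  norm_num [qPochPow_one_two_eq] at E_one E_five theta
  rw [theta (by norm_num) (by norm_num), theta (by norm_num) (by norm_num), E_one, E_five,
    E_eq_qPochPow 10]
  norm_num
  ring

theorem thetaSeries_five_two_mul_five_three : Θ 5 2 1 * Θ 5 3 1 * (Θ 5 2 (-1) * Θ 5 3 (-1)) =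
    E 10 ^ 3 * Θ 5 4 (-1) := by
  have theta {k : ℤ} (hk : 0 ≤ k) (hk5 : k ≤ 10) := thetaSeries_eq_qPochPow (r := 5)
    (by norm_num) hk hk5
  have double {k : ℤ} (hk : 0 ≤ k) := qPochPow_neg_one_mul k hk (n := 10) (by norm_num)
  have split_four := qPochPow_split 1 (i := 4) (n := 10) (by norm_num) (by norm_num) two_ne_zero
  have split_six := qPochPow_split 1 (i := 6) (n := 10) (by norm_num) (by norm_num) two_ne_zero
  have double_two := double (k := 2) (by norm_num)
  have double_three := double (k := 3) (by norm_num)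
  have double_seven := double (k := 7) (by norm_num)
  have double_eight := double (k := 8) (by norm_num)
  simp only [Finset.prod_range_succ, Finset.prod_range_zero, one_mul] at split_four split_six
  norm_num at split_four split_six double_two double_three double_seven double_eight theta
  simp only [theta (k := 2) (by norm_num) (by norm_num), theta (k := 3) (by norm_num) (by norm_num),
    theta (k := 4) (by norm_num) (by norm_num)]
  norm_num
  rw [split_four, split_six, ← double_two, ← double_three, ← double_seven, ← double_eight,
    E_eq_qPochPow]
  norm_num
  ring

theorem thetaSeries_five_two_mul_five_four_mul_E :
    Θ 5 2 1 * Θ 5 4 1 * E 2 * E 20 = E 4 * E 10 ^ 3 := by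
  have theta {k : ℤ} (hk : 0 ≤ k) (hk5 : k ≤ 10) := thetaSeries_eq_qPochPow (r := 5)
    (by norm_num) hk hk5 1
  have double {k : ℤ} (hk : 0 ≤ k) := qPochPow_neg_one_mul k hk (n := 10) (by norm_num)
  have double_two := double (k := 2) (by norm_num)
  have double_four := double (k := 4) (by norm_num)
  have double_six := double (k := 6) (by norm_num)
  have double_eight := double (k := 8) (by norm_num)
  have split_four := qPochPow_split 1 (i := 4) (n := 4) (m := 5) (by norm_num) (by norm_num)
    (by norm_num)
  norm_num [Finset.prod_range_succ] at theta split_four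
  norm_num at double_two double_four double_six double_eight
  rw [theta (by norm_num) (by norm_num), theta (by norm_num) (by norm_num), E_two_eq,
    E_eq_qPochPow 4, E_eq_qPochPow 10, E_eq_qPochPow 20]
  norm_num
  rw [split_four, ← double_two, ← double_four, ← double_six, ← double_eight]
  ring

/-! ### Theta functions of level 10 -/

theorem isUnit_E {j : ℕ} (hj : j ≠ 0) : IsUnit (E j) :=
  isUnit_qPochInf (by simp [hj]) (by simp [hj])

theorem theta_X_pow_X_pow {i j r : ℕ} (hr : i + j = 2 * r) : theta (X ^ i) (X ^ j) = Θ r i 1 := by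
  unfold theta thetaSeries
  refine tsum_congr fun n => ?_
  have tri := two_mul_tri n
  have tri_pred := two_mul_tri (n - 1)
  rw [sub_add_cancel, mul_comm (n - 1) n] at tri_pred
  obtain ⟨s, hs⟩ := Int.eq_ofNat_of_zero_le
    (show 0 ≤ n * (n + 1) / 2 from
      Int.ediv_nonneg (by nlinarith [sq_nonneg (2 * n + 1)]) two_pos.le)
  obtain ⟨t, ht⟩ := Int.eq_ofNat_of_zero_le
    (show 0 ≤ n * (n - 1) / 2 from
      Int.ediv_nonneg (by nlinarith [sq_nonneg (2 * n - 1)]) two_pos.le)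
  rw [hs] at tri
  rw [ht] at tri_pred
  have exponent_eq : (r : ℤ) * (n * (n - 1)) + i * n = ((i * s + j * t : ℕ) : ℤ) := by
    have hr' : (i : ℤ) + j = 2 * r := mod_cast hr
    have s_eq : (s : ℤ) = t + n := by lia
    push_cast
    rw [s_eq, ← tri_pred]
    linear_combination -(t : ℤ) * hr'
  rw [hs, ht, Int.toNat_natCast, Int.toNat_natCast, one_zpow, exponent_eq, qPow_one_natCast,
    ← pow_mul, ← pow_mul, pow_add]

theorem phi_X_pow (j : ℕ) : phi (X ^ j) = Θ j j 1 :=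
  theta_X_pow_X_pow (two_mul j).symm

theorem psi_X_pow (j : ℕ) : psi (X ^ j) = Θ (2 * j) j 1 := by
  rw [psi, ← pow_mul, theta_X_pow_X_pow (r := 2 * j) (by ring)]
  push_cast
  rfl

/-- The combination `φ(q²) φ(q¹⁰) - 4 q³ ψ(q⁴) ψ(q²⁰)` of the dissection formula, in terms of
`thetaSeries`. -/
noncomputable def phiPsi : ℤ⟦X⟧ := Θ 2 2 1 * Θ 10 10 1 - 4 * X ^ 3 * Θ 8 4 1 * Θ 40 20 1

theorem phiPsi_eq :
    phiPsi = phi (X ^ 2) * phi (X ^ 10) - 4 * X ^ 3 * psi (X ^ 4) * psi (X ^ 20) := by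
  rw [phi_X_pow, phi_X_pow, psi_X_pow, psi_X_pow, phiPsi]
  norm_num

theorem thetaSeries_self_eq_add {r : ℤ} (hr : 0 < r) (ε : ℤˣ) :
    Θ r r ε = Θ (4 * r) (4 * r) 1 + 2 * qPow ε r * Θ (16 * r) (8 * r) 1 := by
  have reflect := thetaSeries_reflect (4 * r) 0 1
  have theta_zero := thetaSeries_zero_one (r := 4 * r) (by lia)
  rw [thetaSeries_eq_even_add_odd hr hr.le le_rfl]
  ring_nf at reflect theta_zero ⊢
  rw [reflect, theta_zero]
  ring

theorem two_mul_expand_phiPsi : 2 * expand 2 two_ne_zero phiPsi =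
    Θ 1 1 1 * Θ 5 5 (-1) + Θ 1 1 (-1) * Θ 5 5 1 := by
  have theta_one (ε : ℤˣ) := thetaSeries_self_eq_add one_pos ε
  have theta_five (ε : ℤˣ) := thetaSeries_self_eq_add (r := 5) (by norm_num) ε
  simp only [phiPsi, theta_one, theta_five, qPow_neg, qPow_one_one, qPow_one_ofNat, map_sub,
    map_mul, map_pow, expand_X, map_ofNat]
  repeat rw [expand_thetaSeries _ (by norm_num) (by norm_num) (by norm_num)]
  norm_num
  ring

theorem thetaSeries_one_one_neg_one_sq :
    Θ 1 1 (-1) ^ 2 = Θ 5 5 (-1) ^ 2 - 4 * (X * Θ 5 1 (-1) * Θ 5 3 (-1)) := by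
  rw [thetaSeries_one_one_sq, qPow_neg, qPow_one_one]
  ring

theorem thetaSeries_one_one_one_sq :
    Θ 1 1 1 ^ 2 = Θ 5 5 1 ^ 2 + 4 * (X * Θ 5 1 1 * Θ 5 3 1) := by
  rw [thetaSeries_one_one_sq, qPow_one_one]

theorem phiPsi_sq :
    phiPsi ^ 2 = Θ 5 5 (-1) ^ 4 + 4 * (X * Θ 5 1 (-1) * Θ 5 3 (-1)) ^ 2 := by
  refine expand_injective two_ne_zero (mul_left_cancel₀ (pow_ne_zero 2 two_ne_zero_powerSeries) ?_)
  have sq_neg_expand := congrArg (expand 2 two_ne_zero) thetaSeries_one_one_neg_one_sq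
  have prod_one := thetaSeries_one_mul_neg_one (r := 1) (k := 1) one_pos zero_le_one le_rfl
  have prod_five {k : ℤ} (hk : 0 ≤ k) (hk5 : k ≤ 5) :=
    thetaSeries_one_mul_neg_one (r := 5) (by norm_num) hk hk5
  have prod_five_one := prod_five (k := 1) (by norm_num) (by norm_num)
  have prod_five_three := prod_five (k := 3) (by norm_num) (by norm_num)
  have prod_five_five := prod_five (k := 5) (by norm_num) (by norm_num)
  rw [map_pow, ← mul_pow, two_mul_expand_phiPsi]
  simp only [map_sub, map_add, map_mul, map_pow, expand_X, map_ofNat] at sq_neg_expand ⊢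
  repeat rw [expand_thetaSeries _ (by norm_num) (by norm_num) (by norm_num)] at sq_neg_expand
  repeat rw [expand_thetaSeries _ (by norm_num) (by norm_num) (by norm_num)]
  norm_num at sq_neg_expand prod_one prod_five_one prod_five_three prod_five_five ⊢
  linear_combination (Θ 5 5 (-1) ^ 2 - Θ 1 1 (-1) ^ 2) * thetaSeries_one_one_one_sq +
    (Θ 5 5 1 ^ 2 - (Θ 5 5 1 ^ 2 + 4 * (X * Θ 5 1 1 * Θ 5 3 1))) * thetaSeries_one_one_neg_one_sq +
    (2 * Θ 5 5 1 * Θ 5 5 (-1) + Θ 1 1 1 * Θ 1 1 (-1) + Θ 2 2 (-1) ^ 2) * prod_one +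
    (2 * Θ 2 2 (-1) ^ 2 + Θ 5 5 1 * Θ 5 5 (-1) + Θ 10 10 (-1) ^ 2) * prod_five_five +
    (3 * Θ 10 10 (-1) ^ 2 + Θ 2 2 (-1) ^ 2 - 4 * (X ^ 2 * Θ 10 2 (-1) * Θ 10 6 (-1))) *
      sq_neg_expand +
    16 * X ^ 2 * (Θ 5 3 1 * Θ 5 3 (-1) * prod_five_one +
      Θ 10 2 (-1) * Θ 10 10 (-1) * prod_five_three)

theorem thetaSeries_five_sextic :
    Θ 5 5 (-1) * (X * Θ 5 4 (-1) ^ 2 * Θ 5 1 (-1) ^ 3 + Θ 5 2 (-1) ^ 2 * Θ 5 3 (-1) ^ 3) =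
      Θ 5 1 (-1) * Θ 5 2 (-1) * Θ 5 3 (-1) * Θ 5 4 (-1) *
        (Θ 5 5 (-1) ^ 2 + 2 * (X * Θ 5 1 (-1) * Θ 5 3 (-1))) := by
  have rel₁ := thetaSeries_three_term (r := 5) (c := 1) (x := 3) (y := 2) (z := 1)
    (by lia) (by lia) (by lia) (by lia) (by lia) (by lia)
  have rel₂ := thetaSeries_three_term (r := 5) (c := 1) (x := 4) (y := 2) (z := 1)
    (by lia) (by lia) (by lia) (by lia) (by lia) (by lia)
  have rel₃ := thetaSeries_three_term (r := 5) (c := 1) (x := 4) (y := 3) (z := 1)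
    (by lia) (by lia) (by lia) (by lia) (by lia) (by lia)
  have reflect_six : Θ 5 6 (-1) = Θ 5 4 (-1) := thetaSeries_reflect 5 4 (-1)
  have reflect_seven : Θ 5 7 (-1) = Θ 5 3 (-1) := thetaSeries_reflect 5 3 (-1)
  have reflect_eight : Θ 5 8 (-1) = Θ 5 2 (-1) := thetaSeries_reflect 5 2 (-1)
  norm_num [reflect_six, reflect_seven, reflect_eight, qPow_one_one, qPow_one_ofNat]
    at rel₁ rel₂ rel₃
  refine mul_left_cancel₀
    (thetaSeries_ne_zero (r := 5) (k := 4) (by norm_num) (by norm_num) (-1)) ?_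
  linear_combination Θ 5 4 (-1) * Θ 5 3 (-1) ^ 2 * rel₁ -
    Θ 5 1 (-1) * Θ 5 4 (-1) * (X * Θ 5 1 (-1) * rel₂ - Θ 5 3 (-1) * rel₃)

theorem two_mul_X_mul_thetaSeries_eq : 2 * X * Θ 5 5 (-1) * Θ 5 4 (-1) * Θ 5 1 (-1) ^ 2 =
    Θ 5 2 (-1) * Θ 5 3 (-1) *
      (Θ 5 5 (-1) ^ 2 + 2 * (X * Θ 5 1 (-1) * Θ 5 3 (-1)) - phiPsi) := by
  have coeff_one {k : ℤ} (hk : 0 < k) (hk10 : k < 10) : constantCoeff (Θ 5 k (-1)) = 1 :=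
    constantCoeff_thetaSeries hk (by lia) _
  have ne_zero {k : ℤ} (hk : 0 < k) (hk10 : k < 10) : Θ 5 k (-1) ≠ 0 :=
    thetaSeries_ne_zero hk (by lia) _
  have one_ne := ne_zero (k := 1) (by norm_num) (by norm_num)
  have four_ne := ne_zero (k := 4) (by norm_num) (by norm_num)
  have sextic := thetaSeries_five_sextic
  have sq_eq := phiPsi_sq
  have phiPsi_const : constantCoeff phiPsi = 1 := by simp [phiPsi, constantCoeff_thetaSeries]
  set J₁ := Θ 5 1 (-1) with hJ₁
  set J₂ := Θ 5 2 (-1) with hJ₂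
  set J₃ := Θ 5 3 (-1) with hJ₃
  set J₄ := Θ 5 4 (-1) with hJ₄
  set J₅ := Θ 5 5 (-1) with hJ₅
  have sub_mul_add_eq_zero :
      (J₅ * (J₂ ^ 2 * J₃ ^ 3 - X * J₄ ^ 2 * J₁ ^ 3) - J₁ * J₂ * J₃ * J₄ * phiPsi) *
        (J₅ * (J₂ ^ 2 * J₃ ^ 3 - X * J₄ ^ 2 * J₁ ^ 3) + J₁ * J₂ * J₃ * J₄ * phiPsi) = 0 := by
    linear_combination (J₅ * (X * J₄ ^ 2 * J₁ ^ 3 + J₂ ^ 2 * J₃ ^ 3) + J₁ * J₂ * J₃ * J₄ *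
      (J₅ ^ 2 + 2 * (X * J₁ * J₃))) * sextic - (J₁ * J₂ * J₃ * J₄) ^ 2 * sq_eq
  rcases mul_eq_zero.mp sub_mul_add_eq_zero with sub_eq_zero | add_eq_zero
  · refine mul_left_cancel₀ (mul_ne_zero one_ne four_ne) ?_
    linear_combination sextic - sub_eq_zero
  · -- The constant coefficient of the second factor is `2`.
    have const_eq := congrArg constantCoeff add_eq_zero
    simp [hJ₁, hJ₂, hJ₃, hJ₄, hJ₅, coeff_one, phiPsi_const] at const_eq

/-- The generating function of the coefficients `a_{3,10}(2 n + 1)`. -/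
noncomputable def oddPart : ℤ⟦X⟧ := PowerSeries.mk fun n => a 3 10 (2 * n + 1)

theorem two_mul_oddPart_mul_thetaSeries :
    2 * oddPart * (Θ 5 1 (-1) * Θ 5 3 (-1)) ^ 2 * Θ 5 5 (-1) ^ 3 = E 5 ^ 3 * E 10 ^ 3 *
      (Θ 5 5 (-1) ^ 2 + 2 * (X * Θ 5 1 (-1) * Θ 5 3 (-1)) - phiPsi) := by
  have theta_ne_zero {k : ℤ} (hk : 0 < k) (hk10 : k < 10) : Θ 5 k (-1) ≠ 0 :=
    thetaSeries_ne_zero hk (by lia) _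
  have reflect := thetaSeries_reflect 5 2 1
  have odd_part := odd_part_appellSeries (r := 5) (c := 1) (by norm_num)
  norm_num at reflect odd_part
  rw [reflect] at odd_part
  refine mul_left_cancel₀ (mul_ne_zero (theta_ne_zero (k := 2) (by norm_num) (by norm_num))
    (theta_ne_zero (k := 3) (by norm_num) (by norm_num))) ?_
  rw [oddPart]
  linear_combination 2 * Θ 5 2 (-1) * Θ 5 3 (-1) * Θ 5 5 (-1) * Θ 5 1 (-1) ^ 2 * odd_part +
    2 * X * E 5 ^ 3 * Θ 5 5 (-1) * Θ 5 1 (-1) ^ 2 * thetaSeries_five_two_mul_five_three +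
    E 5 ^ 3 * E 10 ^ 3 * two_mul_X_mul_thetaSeries_eq

theorem two_mul_oddPart_mul_E : 2 * oddPart * (E 1 ^ 2 * E 5) =
    E 2 ^ 2 * (Θ 5 5 (-1) ^ 2 + 2 * (X * Θ 5 1 (-1) * Θ 5 3 (-1)) - phiPsi) := by
  have theta_prod := thetaSeries_five_one_mul_five_three_mul_E
  have theta_five := thetaSeries_self_neg_one_mul_E (r := 5) (by norm_num)
  push_cast at theta_five
  refine mul_left_cancel₀ (mul_ne_zero (pow_ne_zero 5 (isUnit_E (j := 5) (by norm_num)).ne_zero)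
    (pow_ne_zero 6 (isUnit_E (j := 10) (by norm_num)).ne_zero)) ?_
  linear_combination E 2 ^ 2 * E 5 ^ 2 * E 10 ^ 3 * two_mul_oddPart_mul_thetaSeries -
    2 * oddPart * Θ 5 5 (-1) ^ 3 * E 10 ^ 3 *
      (Θ 5 1 (-1) * Θ 5 3 (-1) * E 2 * E 5 + E 1 * E 10 ^ 3) * theta_prod -
    2 * oddPart * (E 1 * E 10 ^ 3) ^ 2 *
      ((Θ 5 5 (-1) * E 10) ^ 2 + Θ 5 5 (-1) * E 10 * E 5 ^ 2 + E 5 ^ 4) * theta_five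

theorem two_mul_oddPart_eq : 2 * oddPart = E 1 ^ 2 * Ring.inverse (E 5) +
    6 * X * (E 2 * E 10 ^ 3) * Ring.inverse (E 1 * E 5 ^ 2) -
      E 2 ^ 2 * Ring.inverse (E 1 ^ 2 * E 5) * phiPsi := by
  have unit_one := isUnit_E one_ne_zero
  have unit_five := isUnit_E (show 5 ≠ 0 by norm_num)
  have theta_one := thetaSeries_self_neg_one_mul_E one_ne_zero
  norm_num at theta_one
  have inv_five := Ring.mul_inverse_cancel _ unit_five
  have inv_mid := Ring.mul_inverse_cancel _ (unit_one.mul (unit_five.pow 2))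
  have inv_last := Ring.mul_inverse_cancel _ ((unit_one.pow 2).mul unit_five)
  refine mul_left_cancel₀ ((unit_one.pow 2).mul (unit_five.pow 2)).ne_zero ?_
  linear_combination E 5 * two_mul_oddPart_mul_E - E 5 * E 2 ^ 2 * thetaSeries_one_one_neg_one_sq +
    E 5 * (Θ 1 1 (-1) * E 2 + E 1 ^ 2) * theta_one +
    6 * X * E 2 * thetaSeries_five_one_mul_five_three_mul_E - E 1 ^ 4 * E 5 * inv_five -
    6 * X * E 2 * E 10 ^ 3 * E 1 * inv_mid + E 2 ^ 2 * E 5 * phiPsi * inv_last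

/-! ### The congruence modulo 5 -/

/-- Splitting the integers into residue classes modulo `2 h + 1`, with the representatives
`-h, …, h`. -/
def oddResidueEquiv (h : ℕ) : Fin (2 * h + 1) × ℤ ≃ ℤ where
  toFun x := (2 * h + 1) * x.2 + (x.1.val - h)
  invFun n := (⟨((n + h) % (2 * h + 1)).toNat, by
    have := Int.emod_nonneg (n + h) (show (2 * h + 1 : ℤ) ≠ 0 by lia)
    have := Int.emod_lt_of_pos (n + h) (show (0 : ℤ) < 2 * h + 1 by lia)
    lia⟩, (n + h) / (2 * h + 1))
  left_inv := by
    rintro ⟨⟨b, hb⟩, l⟩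
    have shift : (2 * h + 1) * l + ((b : ℤ) - h) + h = b + (2 * h + 1) * l := by ring
    simp only [shift, Prod.mk.injEq, Fin.mk.injEq]
    rw [Int.add_mul_emod_self_left, Int.add_mul_ediv_left _ _ (by lia),
      Int.emod_eq_of_lt (by lia) (by lia), Int.ediv_eq_zero_of_lt (by lia) (by lia)]
    exact ⟨Int.toNat_natCast b, zero_add l⟩
  right_inv n := by
    have := Int.emod_nonneg (n + h) (show (2 * h + 1 : ℤ) ≠ 0 by lia)
    have := Int.mul_ediv_add_emod (n + h) (2 * h + 1)
    dsimp only
    lia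

theorem thetaSeries_eq_sum_residues (h : ℕ) {r k : ℤ} (h0 : 0 < r) (hk : 0 ≤ k) (hkr : k ≤ 2 * r)
    (ε : ℤˣ) : Θ r k ε = ∑ b : Fin (2 * h + 1),
      qPow (ε ^ (b - h : ℤ)) (r * ((b - h) * (b - h - 1)) + k * (b - h)) *
        Θ ((2 * h + 1) ^ 2 * r) ((2 * h + 1) * (2 * r * b + k)) (ε ^ (2 * h + 1)) := by
  unfold thetaSeries
  rw [(isNullFamily_thetaTerm h0 hk hkr (ε ^ ·)).tsum_eq_sum_tsum (oddResidueEquiv h)]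
  refine Finset.sum_congr rfl fun b _ => ?_
  have hb : (b : ℤ) ≤ 2 * h := by exact_mod_cast b.is_le
  have exp_nonneg : 0 ≤ (2 * h + 1) * (2 * r * (b : ℤ) + k) := by positivity
  have exp_le : (2 * h + 1) * (2 * r * (b : ℤ) + k) ≤ 2 * ((2 * h + 1) ^ 2 * r) := by
    nlinarith [mul_nonneg h0.le (sub_nonneg.mpr hb)]
  rw [(isNullFamily_thetaTerm (by positivity) exp_nonneg exp_le _).mul_tsum]
  refine tsum_congr fun n => ?_
  rw [qPow_mul_qPow _ _ (thetaExponent_nonneg hk hkr _) (thetaExponent_nonneg exp_nonneg exp_le n)]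
  simp only [oddResidueEquiv, Equiv.coe_fn_mk]
  congr 1
  · rw [add_comm, zpow_add, zpow_mul]
    norm_cast
  · ring

theorem thetaSeries_four_two_eq : Θ 4 2 1 = expand 5 (by norm_num) (Θ 5 4 1) +
    X ^ 2 * expand 5 (by norm_num) (Θ 5 2 1) + X ^ 6 * expand 5 (by norm_num) (Θ 20 10 1) := by
  have even_odd_four := thetaSeries_eq_even_add_odd (r := 5) (k := 4) (by norm_num) (by norm_num)
    (by norm_num) 1
  have even_odd_two := thetaSeries_eq_even_add_odd (r := 5) (k := 2) (by norm_num) (by norm_num)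
    (by norm_num) 1
  have residues := thetaSeries_eq_sum_residues 2 (r := 4) (k := 2) (by norm_num) (by norm_num)
    (by norm_num) 1
  have reflect_ten := thetaSeries_reflect 100 190 1
  have reflect_seventy := thetaSeries_reflect 100 130 1
  rw [even_odd_four, even_odd_two, residues]
  norm_num [Fin.sum_univ_succ, qPow_one_ofNat] at reflect_ten reflect_seventy ⊢
  repeat rw [expand_thetaSeries _ (by norm_num) (by norm_num) (by norm_num)]
  norm_num
  rw [reflect_ten, reflect_seventy]
  ring

section ResidueClasses

variable {R : Type*} [CommRing R] {m : ℕ} {b c : ZMod m} {f g : R⟦X⟧}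

/-- The exponents occurring in `f` lie in the residue class `c` modulo `m`. -/
def IsSupportedOnClass (c : ZMod m) (f : R⟦X⟧) : Prop := ∀ n : ℕ, (n : ZMod m) ≠ c → coeff n f = 0

namespace IsSupportedOnClass

theorem mul (hf : IsSupportedOnClass b f) (hg : IsSupportedOnClass c g) :
    IsSupportedOnClass (b + c) (f * g) := by
  intro n hn
  rw [coeff_mul]
  refine Finset.sum_eq_zero fun x hx => ?_
  rw [Finset.HasAntidiagonal.mem_antidiagonal] at hx
  by_cases hb : (x.1 : ZMod m) = b
  · rw [hg, mul_zero]
    rintro rfl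
    exact hn (by rw [← hx, ← hb, Nat.cast_add])
  · rw [hf _ hb, zero_mul]

theorem natCast (j : ℕ) : IsSupportedOnClass (0 : ZMod m) (j : R⟦X⟧) := by
  intro n hn
  rw [← map_natCast (C (R := R)), coeff_C, if_neg]
  rintro rfl
  exact hn Nat.cast_zero

theorem X_pow (j : ℕ) : IsSupportedOnClass (j : ZMod m) (X ^ j : R⟦X⟧) := by
  intro n hn
  rw [coeff_X_pow, if_neg]
  rintro rfl
  exact hn rfl

theorem pow (hf : IsSupportedOnClass c f) (j : ℕ) :
    IsSupportedOnClass ((j : ZMod m) * c) (f ^ j) := by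
  induction j with
  | zero => simpa only [Nat.cast_zero, zero_mul, pow_zero, Nat.cast_one] using natCast 1
  | succ j ih =>
    rw [pow_succ, Nat.cast_succ, add_one_mul]
    exact ih.mul hf

theorem expand (hm : m ≠ 0) (f : R⟦X⟧) :
    IsSupportedOnClass (0 : ZMod m) (PowerSeries.expand m hm f) := fun n hn =>
  coeff_expand_of_not_dvd _ _ _ fun h => hn ((ZMod.natCast_eq_zero_iff n m).mpr h)

end IsSupportedOnClass

/-- The coefficients of `f` with index in the residue class `c` modulo `m` are divisible by `d`. -/
def DvdOnClass (d : R) (c : ZMod m) (f : R⟦X⟧) : Prop := ∀ n : ℕ, (n : ZMod m) = c → d ∣ coeff n f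

theorem IsSupportedOnClass.dvdOnClass (hf : IsSupportedOnClass b f) (hc : c ≠ b) (d : R) :
    DvdOnClass d c f := by
  rintro n rfl
  rw [hf n hc]
  exact dvd_zero _

namespace DvdOnClass

variable {d : R}

theorem add (hf : DvdOnClass d c f) (hg : DvdOnClass d c g) : DvdOnClass d c (f + g) :=
  fun n hn => by
    rw [map_add]
    exact dvd_add (hf n hn) (hg n hn)

theorem sub (hf : DvdOnClass d c f) (hg : DvdOnClass d c g) : DvdOnClass d c (f - g) :=
  fun n hn => by
    rw [map_sub]
    exact dvd_sub (hf n hn) (hg n hn)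

theorem C_mul (d : R) (c : ZMod m) (f : R⟦X⟧) : DvdOnClass d c (C d * f) := fun n _ => by
  rw [coeff_C_mul]
  exact dvd_mul_right _ _

theorem of_C_mul {e : R} (hde : IsCoprime d e) (h : DvdOnClass d c (C e * f)) :
    DvdOnClass d c f := fun n hn =>
  hde.dvd_of_dvd_mul_left (by simpa only [coeff_C_mul] using h n hn)

theorem expand_mul (hm : m ≠ 0) (hf : DvdOnClass d c f) (g : R⟦X⟧) :
    DvdOnClass d c (expand m hm g * f) := by
  rintro n rfl
  rw [coeff_mul]
  refine Finset.dvd_sum fun x hx => ?_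
  rw [Finset.HasAntidiagonal.mem_antidiagonal] at hx
  by_cases h : (x.1 : ZMod m) = 0
  · exact (hf _ (by rw [← hx, Nat.cast_add, h, zero_add])).mul_left _
  · rw [IsSupportedOnClass.expand hm g _ h, zero_mul]
    exact dvd_zero _

theorem of_expand_mul (hm : m ≠ 0) (hg : IsUnit g) (h : DvdOnClass d c (expand m hm g * f)) :
    DvdOnClass d c f := by
  have mul_inverse := h.expand_mul hm (Ring.inverse g)
  rwa [← mul_assoc, ← map_mul, Ring.inverse_mul_cancel _ hg, map_one, one_mul] at mul_inverse

theorem of_expand {j : ℕ} (hj : j ≠ 0) (h : DvdOnClass d ((j : ZMod m) * c) (expand j hj f)) :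
    DvdOnClass d c f := by
  rintro n rfl
  simpa only [coeff_expand_mul] using h (j * n) (Nat.cast_mul j n)

theorem rescale (hf : DvdOnClass d c f) (e : R) : DvdOnClass d c (rescale e f) := fun n hn => by
  rw [coeff_rescale]
  exact (hf n hn).mul_left _

end DvdOnClass

end ResidueClasses

section FiveDissection

variable {R : Type*} [CommRing R] {A B C : R⟦X⟧}

theorem dvdOnClass_monomial (hA : IsSupportedOnClass (0 : ZMod 5) A)
    (hB : IsSupportedOnClass (2 : ZMod 5) B) (hC : IsSupportedOnClass (1 : ZMod 5) C)
    {c : ZMod 5} (n i j k : ℕ) (hc : c ≠ j * 2 + k) (d : R) :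
    DvdOnClass d c (n * (A ^ i * B ^ j * C ^ k)) := by
  refine ((IsSupportedOnClass.natCast n).mul
    (((hA.pow i).mul (hB.pow j)).mul (hC.pow k))).dvdOnClass ?_ d
  simpa only [mul_zero, zero_add, mul_one] using hc

theorem five_dvdOnClass_quartic (hA : IsSupportedOnClass (0 : ZMod 5) A)
    (hB : IsSupportedOnClass (2 : ZMod 5) B) (hC : IsSupportedOnClass (1 : ZMod 5) C) :
    DvdOnClass 5 (4 : ZMod 5) ((A + B + C) ^ 4 - (A * B + C ^ 2) ^ 2) := by
  have term (n i j k : ℕ) (hc : (4 : ZMod 5) ≠ j * 2 + k) :=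
    dvdOnClass_monomial hA hB hC n i j k hc 5
  -- The terms of class `4` in `(A + B + C)⁴` are `6 A² B² + 12 A B C² + C⁴`.
  have sum := (term 1 4 0 0 (by decide)).add <| (term 4 3 1 0 (by decide)).add <|
    (term 4 1 3 0 (by decide)).add <| (term 1 0 4 0 (by decide)).add <|
    (term 4 3 0 1 (by decide)).add <| (term 12 2 1 1 (by decide)).add <|
    (term 12 1 2 1 (by decide)).add <| (term 4 0 3 1 (by decide)).add <|
    (term 6 2 0 2 (by decide)).add <| (term 6 0 2 2 (by decide)).add <|
    (term 4 1 0 3 (by decide)).add <| (term 4 0 1 3 (by decide)).add <|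
    DvdOnClass.C_mul 5 4 (A ^ 2 * B ^ 2 + 2 * (A * B * C ^ 2))
  convert sum using 1
  rw [map_ofNat]
  push_cast
  ring

theorem five_dvdOnClass_cubic (hA : IsSupportedOnClass (0 : ZMod 5) A)
    (hB : IsSupportedOnClass (2 : ZMod 5) B) (hC : IsSupportedOnClass (1 : ZMod 5) C) :
    DvdOnClass 5 (3 : ZMod 5) ((A + B + C) ^ 3 - (A * B + C ^ 2) * (A + B + C)) := by
  have term (n i j k : ℕ) (hc : (3 : ZMod 5) ≠ j * 2 + k) :=
    dvdOnClass_monomial hA hB hC n i j k hc 5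
  -- The terms of class `3` in `(A + B + C)³` are `6 A B C + C³`.
  have sum := (term 1 3 0 0 (by decide)).add <| (term 2 2 1 0 (by decide)).add <|
    (term 2 1 2 0 (by decide)).add <| (term 1 0 3 0 (by decide)).add <|
    (term 3 2 0 1 (by decide)).add <| (term 3 0 2 1 (by decide)).add <|
    (term 2 1 0 2 (by decide)).add <| (term 2 0 1 2 (by decide)).add <|
    DvdOnClass.C_mul 5 3 (A * B * C)
  convert sum using 1
  rw [map_ofNat]
  push_cast
  ring

theorem isSupportedOnClass_X_pow_mul_expand (j : ℕ) (f : R⟦X⟧) :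
    IsSupportedOnClass (j : ZMod 5) (X ^ j * expand 5 (by norm_num) f) := by
  simpa only [add_zero] using
    (IsSupportedOnClass.X_pow (m := 5) j).mul (.expand (by norm_num) f)

end FiveDissection

theorem X_sq_mul_thetaSeries_twenty_ten_sq : X ^ 2 * Θ 20 10 1 ^ 2 =
    expand 5 (by norm_num) (Θ 5 4 1) * (X ^ 2 * expand 5 (by norm_num) (Θ 5 2 1)) +
      (X ^ 6 * expand 5 (by norm_num) (Θ 20 10 1)) ^ 2 := by
  have sq_expand := congrArg (expand 5 (by norm_num)) thetaSeries_four_two_sq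
  rw [map_pow, map_add, map_mul, map_mul, map_pow, map_pow, expand_X,
    expand_thetaSeries _ (r := 4) (by norm_num) (by norm_num) (by norm_num)] at sq_expand
  norm_num at sq_expand
  linear_combination X ^ 2 * sq_expand

theorem five_dvdOnClass_thetaSeries_quartic :
    DvdOnClass 5 (4 : ZMod 5) (Θ 4 2 1 ^ 4 - (X ^ 2 * Θ 20 10 1 ^ 2) ^ 2) := by
  rw [X_sq_mul_thetaSeries_twenty_ten_sq, thetaSeries_four_two_eq]
  exact five_dvdOnClass_quartic (.expand _ _) (isSupportedOnClass_X_pow_mul_expand 2 _)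
    (isSupportedOnClass_X_pow_mul_expand 6 _)

theorem five_dvdOnClass_thetaSeries_cubic :
    DvdOnClass 5 (3 : ZMod 5) (Θ 4 2 1 ^ 3 - X ^ 2 * Θ 20 10 1 ^ 2 * Θ 4 2 1) := by
  rw [X_sq_mul_thetaSeries_twenty_ten_sq, thetaSeries_four_two_eq]
  exact five_dvdOnClass_cubic (.expand _ _) (isSupportedOnClass_X_pow_mul_expand 2 _)
    (isSupportedOnClass_X_pow_mul_expand 6 _)

/-- The Euler quotient `E₂ / E₁`. -/
noncomputable def eulerQuot : ℤ⟦X⟧ := E 2 * Ring.inverse (E 1)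

theorem eulerQuot_mul_E_one : eulerQuot * E 1 = E 2 := by
  rw [eulerQuot, mul_assoc, Ring.inverse_mul_cancel _ (isUnit_E one_ne_zero), mul_one]

theorem expand_eulerQuot_mul_E_two : expand 2 two_ne_zero eulerQuot * E 2 = E 4 := by
  have quot_expand := congrArg (expand 2 two_ne_zero) eulerQuot_mul_E_one
  rwa [map_mul, expand_E _ one_ne_zero, expand_E _ two_ne_zero] at quot_expand

theorem thetaSeries_five_five_neg_one_mul_E : Θ 5 5 (-1) * E 10 = E 5 ^ 2 := by
  simpa using thetaSeries_self_neg_one_mul_E (r := 5) (by norm_num)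

theorem thetaSeries_ten_five_mul_E : Θ 10 5 1 * E 5 = E 10 ^ 2 := by
  simpa using thetaSeries_two_mul_self_one_mul_E (r := 5) (by norm_num)

theorem eulerQuot_mul_E_five_pow :
    eulerQuot * E 5 ^ 3 = E 10 * (Θ 2 1 1 ^ 2 - X * Θ 10 5 1 ^ 2) := by
  refine expand_injective two_ne_zero ?_
  simp only [map_mul, map_pow, map_sub, expand_X]
  rw [expand_E _ (by norm_num), expand_E _ (by norm_num),
    expand_thetaSeries _ (by norm_num) (by norm_num) (by norm_num),
    expand_thetaSeries _ (by norm_num) (by norm_num) (by norm_num)]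
  norm_num
  refine mul_left_cancel₀ (isUnit_E two_ne_zero).ne_zero ?_
  linear_combination E 10 ^ 3 * expand_eulerQuot_mul_E_two -
    thetaSeries_five_two_mul_five_four_mul_E - E 20 * E 2 * thetaSeries_four_two_sq

theorem E_five_sq_mul_eulerQuot_sq_mul_thetaSeries :
    E 5 ^ 2 * (eulerQuot ^ 2 * (Θ 5 5 (-1) ^ 2 + 2 * (X * Θ 5 1 (-1) * Θ 5 3 (-1)))) =
      Θ 2 1 1 ^ 4 - (X * Θ 10 5 1 ^ 2) ^ 2 := by
  have five_ne := (isUnit_E (j := 5) (by norm_num)).ne_zero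
  have quot_five := eulerQuot_mul_E_five_pow
  set G := Θ 2 1 1 ^ 2 - X * Θ 10 5 1 ^ 2
  have quot_theta_prod : Θ 5 1 (-1) * Θ 5 3 (-1) * eulerQuot * E 5 = E 10 ^ 3 := by
    refine mul_left_cancel₀ (isUnit_E one_ne_zero).ne_zero ?_
    linear_combination thetaSeries_five_one_mul_five_three_mul_E +
      Θ 5 1 (-1) * Θ 5 3 (-1) * E 5 * eulerQuot_mul_E_one
  have first_term : E 5 ^ 2 * (Θ 5 5 (-1) * eulerQuot) ^ 2 = G ^ 2 := by
    refine mul_left_cancel₀ (pow_ne_zero 4 five_ne) ?_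
    linear_combination Θ 5 5 (-1) ^ 2 * (eulerQuot * E 5 ^ 3 + E 10 * G) * quot_five +
      G ^ 2 * (Θ 5 5 (-1) * E 10 + E 5 ^ 2) * thetaSeries_five_five_neg_one_mul_E
  have second_term : E 5 ^ 2 * (eulerQuot ^ 2 * (X * Θ 5 1 (-1) * Θ 5 3 (-1))) =
      X * Θ 10 5 1 ^ 2 * G := by
    refine mul_left_cancel₀ (pow_ne_zero 2 five_ne) ?_
    linear_combination X * eulerQuot * E 5 ^ 3 * quot_theta_prod + X * E 10 ^ 3 * quot_five -
      X * G * (Θ 10 5 1 * E 5 + E 10 ^ 2) * thetaSeries_ten_five_mul_E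
  linear_combination first_term + 2 * second_term

theorem expand_five_E_one : expand 5 (by norm_num) (E 1) = E 5 := expand_E _ one_ne_zero

theorem five_dvdOnClass_eulerQuot_sq_mul_thetaSeries : DvdOnClass 5 (2 : ZMod 5)
    (eulerQuot ^ 2 * (Θ 5 5 (-1) ^ 2 + 2 * (X * Θ 5 1 (-1) * Θ 5 3 (-1)))) := by
  refine .of_expand_mul (by norm_num) ((isUnit_E one_ne_zero).pow 2) (.of_expand two_ne_zero ?_)
  rw [map_pow, expand_five_E_one, E_five_sq_mul_eulerQuot_sq_mul_thetaSeries]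
  simp only [map_sub, map_mul, map_pow, expand_X]
  rw [expand_thetaSeries _ (by norm_num) (by norm_num) (by norm_num),
    expand_thetaSeries _ (by norm_num) (by norm_num) (by norm_num)]
  norm_num
  exact five_dvdOnClass_thetaSeries_quartic

theorem expand_eulerQuot_sq_mul_thetaSeries :
    expand 2 two_ne_zero eulerQuot ^ 2 * Θ 1 1 1 = eulerQuot * Θ 2 1 1 := by
  have theta_one_one := thetaSeries_self_one_mul_E one_ne_zero
  have theta_two_one := thetaSeries_two_mul_self_one_mul_E one_ne_zero
  norm_num at theta_one_one theta_two_one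
  refine mul_left_cancel₀ (mul_ne_zero (pow_ne_zero 2 (isUnit_E one_ne_zero).ne_zero)
    (pow_ne_zero 2 (isUnit_E two_ne_zero).ne_zero)) ?_
  linear_combination E 1 ^ 2 * Θ 1 1 1 * (expand 2 two_ne_zero eulerQuot * E 2 + E 4) *
      expand_eulerQuot_mul_E_two + theta_one_one - E 2 ^ 2 * E 1 * Θ 2 1 1 * eulerQuot_mul_E_one -
    E 2 ^ 3 * theta_two_one

theorem E_five_mul_expand_eulerQuot_sq_mul_thetaSeries :
    E 5 * (expand 2 two_ne_zero eulerQuot ^ 2 * (Θ 1 1 1 * Θ 5 5 (-1))) =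
      Θ 2 1 1 ^ 3 - X * Θ 10 5 1 ^ 2 * Θ 2 1 1 := by
  refine mul_left_cancel₀ (pow_ne_zero 2 (isUnit_E (j := 5) (by norm_num)).ne_zero) ?_
  linear_combination E 5 ^ 3 * Θ 5 5 (-1) * expand_eulerQuot_sq_mul_thetaSeries +
    Θ 2 1 1 * Θ 5 5 (-1) * eulerQuot_mul_E_five_pow +
    Θ 2 1 1 * (Θ 2 1 1 ^ 2 - X * Θ 10 5 1 ^ 2) * thetaSeries_five_five_neg_one_mul_E

theorem five_dvdOnClass_expand_eulerQuot_sq_mul_thetaSeries : DvdOnClass 5 (4 : ZMod 5)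
    (expand 2 two_ne_zero eulerQuot ^ 2 * (Θ 1 1 1 * Θ 5 5 (-1))) := by
  refine .of_expand_mul (by norm_num) (isUnit_E one_ne_zero) (.of_expand two_ne_zero ?_)
  rw [expand_five_E_one, E_five_mul_expand_eulerQuot_sq_mul_thetaSeries]
  simp only [map_sub, map_mul, map_pow, expand_X]
  rw [expand_thetaSeries _ (by norm_num) (by norm_num) (by norm_num),
    expand_thetaSeries _ (by norm_num) (by norm_num) (by norm_num)]
  norm_num
  exact five_dvdOnClass_thetaSeries_cubic

theorem evalNegHom_expand_two {R : Type*} [CommRing R] (f : R⟦X⟧) :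
    evalNegHom (expand 2 two_ne_zero f) = expand 2 two_ne_zero f := by
  ext n
  rw [evalNegHom, coeff_rescale]
  rcases Nat.even_or_odd n with hn | hn
  · rw [hn.neg_one_pow, one_mul]
  · rw [coeff_expand_of_not_dvd _ _ _ fun h => Nat.not_even_iff_odd.mpr hn (even_iff_two_dvd.mpr h),
      mul_zero]

theorem five_dvdOnClass_eulerQuot_sq_mul_phiPsi :
    DvdOnClass 5 (2 : ZMod 5) (eulerQuot ^ 2 * phiPsi) := by
  refine .of_expand two_ne_zero (.of_C_mul (e := 2) (by norm_num [Int.isCoprime_iff_gcd_eq_one]) ?_)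
  have dvd := five_dvdOnClass_expand_eulerQuot_sq_mul_thetaSeries
  have theta_neg {r : ℤ} (hr : Odd r) (h0 : 0 < r) (ε : ℤˣ) :
      evalNegHom (Θ r r ε) = Θ r r (-ε) := by
    rw [map_thetaSeries one_pos evalNegHom_X_eq_qPow h0 h0.le (by lia), one_mul,
      hr.neg_one_zpow, mul_neg_one]
  suffices expand_eq : C 2 * expand 2 two_ne_zero (eulerQuot ^ 2 * phiPsi) =
      expand 2 two_ne_zero eulerQuot ^ 2 * (Θ 1 1 1 * Θ 5 5 (-1)) +
        evalNegHom (expand 2 two_ne_zero eulerQuot ^ 2 * (Θ 1 1 1 * Θ 5 5 (-1))) by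
    rw [expand_eq]
    exact dvd.add (dvd.rescale (-1))
  rw [map_mul evalNegHom, map_mul evalNegHom, map_pow evalNegHom, evalNegHom_expand_two,
    theta_neg odd_one one_pos, theta_neg (by decide) (by norm_num), neg_neg, map_mul, map_pow,
    map_ofNat]
  linear_combination expand 2 two_ne_zero eulerQuot ^ 2 * two_mul_expand_phiPsi

theorem five_dvdOnClass_oddPart : DvdOnClass 5 (2 : ZMod 5) oddPart := by
  refine .of_C_mul (e := 2) (by norm_num [Int.isCoprime_iff_gcd_eq_one])
    (.of_expand_mul (by norm_num) (isUnit_E one_ne_zero) ?_)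
  convert five_dvdOnClass_eulerQuot_sq_mul_thetaSeries.sub
    five_dvdOnClass_eulerQuot_sq_mul_phiPsi using 1
  refine mul_left_cancel₀ (pow_ne_zero 2 (isUnit_E one_ne_zero).ne_zero) ?_
  rw [expand_five_E_one, map_ofNat]
  linear_combination two_mul_oddPart_mul_E - (eulerQuot * E 1 + E 2) *
    (Θ 5 5 (-1) ^ 2 + 2 * (X * Θ 5 1 (-1) * Θ 5 3 (-1)) - phiPsi) * eulerQuot_mul_E_one

theorem appell_three_ten_modEq_zero (n : ℕ) : a 3 10 (10 * n + 5) ≡ 0 [ZMOD 5] := by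
  have dvd := five_dvdOnClass_oddPart (5 * n + 2) (by
    rw [Nat.cast_add, Nat.cast_mul, ZMod.natCast_self, zero_mul, zero_add, Nat.cast_ofNat])
  rw [oddPart, coeff_mk, show 2 * (5 * n + 2) + 1 = 10 * n + 5 by ring] at dvd
  exact Int.modEq_zero_iff_dvd.mpr dvd

end AppellLerch

theorem mainTheorem5 :
    (2 * PowerSeries.mk (fun n : ℕ => AppellLerch.a 3 10 (2 * n + 1)) =
      AppellLerch.E 1 ^ 2 * Ring.inverse (AppellLerch.E 5)
        + 6 * PowerSeries.X * (AppellLerch.E 2 * AppellLerch.E 10 ^ 3)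
            * Ring.inverse (AppellLerch.E 1 * AppellLerch.E 5 ^ 2)
        - AppellLerch.E 2 ^ 2 * Ring.inverse (AppellLerch.E 1 ^ 2 * AppellLerch.E 5)
            * (AppellLerch.phi (PowerSeries.X ^ 2) * AppellLerch.phi (PowerSeries.X ^ 10)
                - 4 * PowerSeries.X ^ 3 * AppellLerch.psi (PowerSeries.X ^ 4)
                    * AppellLerch.psi (PowerSeries.X ^ 20))) ∧
    ∀ n : ℕ, AppellLerch.a 3 10 (10 * n + 5) ≡ 0 [ZMOD 5] := by
  rw [← AppellLerch.phiPsi_eq]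
  exact ⟨AppellLerch.two_mul_oddPart_eq, AppellLerch.appell_three_ten_modEq_zero⟩
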